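/- There are eleven mosaic tiles: the blank square, four quarter arcs joining the midpoints of two adjacent sides, two straight arcs joining the midpoints of opposite sides, two pairs of disjoint quarter arcs, and two crossings (horizontal strand over, vertical strand over). An $n$-mosaic is an $n\times n$ matrix of tiles. It is an $n$-mosaic link if it is suitably connected, that is, if every end of an arc of a tile lies on a side shared with another tile of the matrix, and is also an end of an arc of that tile; it then is a link diagram. The mosaic number of a link is the smallest $n$ such that some $n$-mosaic link is a diagram of this link, where two diagrams represent the same link if they are related by planar isotopy and Reidemeister moves. Theorem. Let $K$ be a knot diagram, or a link diagram each of whose components passes through at least one crossing, and let $c$ be the number of crossings of $K$. Then the mosaic number $n$ of the link represented by $K$ exists and satisfies $$ n \le 4c+2 . $$ -/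

import Mathlib

/-! ## Link diagrams on the sphere

A link diagram is a plane graph with vertices of degree 4 (the crossings) and of degree 2
(points marked on an arc; they carry no information and may be inserted or removed), so that a
circle without crossings is a cycle of vertices of degree 2.  As usual a plane graph is recorded
by its darts (oriented edges, each based at its starting vertex), the reversal of darts, and the
counterclockwise rotation of the darts around each vertex. -/

structure LinkDiagram where
  Dart : Type
  finite_dart : Finite Dart
  /-- the reversal of a dart -/
  edge : Equiv.Perm Dart
  /-- the next dart counterclockwise around the base vertex -/
  next : Equiv.Perm Dart
  /-- at a crossing: whether the dart belongs to the strand that passes over; at a vertex of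
  degree 2 the value is irrelevant -/
  isOver : Dart → Bool
  edge_edge : ∀ d, edge (edge d) = d
  edge_ne : ∀ d, edge d ≠ d
  next_ne : ∀ d, next d ≠ d
  next_four : ∀ d, next (next (next (next d))) = d
  over_next : ∀ d, next (next d) ≠ d → isOver (next d) = !isOver d

namespace LinkDiagram

/-- The base vertex of the dart has degree 4 (otherwise it has degree 2). -/
def IsCrossing (D : LinkDiagram) (d : D.Dart) : Prop := D.next (D.next d) ≠ d

/-- The vertices: the cycles of the rotation. -/
def Vertex (D : LinkDiagram) : Type := Quotient (Equiv.Perm.SameCycle.setoid D.next)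

/-- The edges: the cycles of the reversal. -/
def Edge (D : LinkDiagram) : Type := Quotient (Equiv.Perm.SameCycle.setoid D.edge)

/-- The faces: the cycles of "reverse, then turn to the next dart". -/
def Face (D : LinkDiagram) : Type := Quotient (Equiv.Perm.SameCycle.setoid (D.next * D.edge))

/-- The connected components of the underlying graph. -/
def Piece (D : LinkDiagram) : Type :=
  Quotient (Relation.EqvGen.setoid fun x y : D.Dart => y = D.edge x ∨ y = D.next x)

/-- Every connected component of the underlying graph has genus zero, that is, Euler's formula
`V - E + F = 2` holds on each of them. (The difference `2 - (V - E + F)` is nonnegative on every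
component, so it is enough to ask for the sum.) -/
def Planar (D : LinkDiagram) : Prop :=
  (Nat.card D.Vertex : ℤ) - Nat.card D.Edge + Nat.card D.Face = 2 * Nat.card D.Piece

/-- The number of crossings of the diagram. -/
noncomputable def numCrossings (D : LinkDiagram) : ℕ :=
  Nat.card {v : D.Vertex // ∃ d, D.IsCrossing d ∧ v = Quotient.mk _ d}

open Classical in
/-- The dart by which a strand leaves the vertex that it entered against `d`: the opposite dart
at a crossing, the other dart at a vertex of degree 2. -/
noncomputable def opposite (D : LinkDiagram) (d : D.Dart) : D.Dart :=
  if D.IsCrossing d then D.next (D.next d) else D.next d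

/-- Two darts lie on the same component of the link. -/
def SameComponent (D : LinkDiagram) : D.Dart → D.Dart → Prop :=
  Relation.EqvGen fun x y => y = D.edge x ∨ y = D.opposite x

/-- The diagram has exactly one link component. -/
def IsKnot (D : LinkDiagram) : Prop :=
  Nonempty D.Dart ∧ ∀ x y, D.SameComponent x y

/-- Every link component passes through at least one crossing. -/
def EveryComponentCrosses (D : LinkDiagram) : Prop :=
  ∀ x, ∃ y, D.SameComponent x y ∧ D.IsCrossing y

/-- `D'` is, up to renaming of darts, the diagram that remains of `D` when the darts in `R` are
deleted, the reversal is replaced by `e` and the rotation by `r`; over and under are kept at the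
crossings of `D'`. -/
def IsModification (D D' : LinkDiagram) (R : Set D.Dart) (e r : D.Dart → D.Dart) : Prop :=
  ∃ f : D'.Dart → D.Dart, Function.Injective f ∧ Set.range f = Rᶜ ∧
    (∀ x, f (D'.edge x) = e (f x)) ∧ (∀ x, f (D'.next x) = r (f x)) ∧
    ∀ x, D'.IsCrossing x → D'.isOver x = D.isOver (f x)

/-- `D'` is `D` with its darts renamed: the two diagrams differ by an orientation preserving
homeomorphism of the sphere (on each connected piece). -/
def Isomorphic (D D' : LinkDiagram) : Prop :=
  D.IsModification D' ∅ D.edge D.next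

open Classical in
/-- `D'` arises from `D` by erasing a vertex of degree 2, with darts `a` and `b`, and joining its
two edges to one. -/
def EraseVertex (D D' : LinkDiagram) : Prop :=
  ∃ a b : D.Dart, D.next a = b ∧ D.next b = a ∧ D.edge a ≠ b ∧
    D.IsModification D' {a, b}
      (Function.update (Function.update D.edge (D.edge a) (D.edge b)) (D.edge b) (D.edge a))
      D.next

open Classical in
/-- First Reidemeister move, in the direction that removes a crossing. The crossing has the darts
`a, next a, next² a, next³ a`, and `a` and `next a` bound a monogon. The two other darts remain
and form a vertex of degree 2. -/
def RemoveMonogon (D D' : LinkDiagram) : Prop :=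
  ∃ a : D.Dart, D.IsCrossing a ∧ D.edge a = D.next a ∧
    D.IsModification D' {a, D.next a} D.edge
      (Function.update D.next (D.next (D.next (D.next a))) (D.next (D.next a)))

open Classical in
/-- Second Reidemeister move, in the direction that removes two crossings. The darts `a, next a`
of one crossing and `b, next b` of another one bound a bigon, and the strand through `next a` and
`b` passes over both crossings or under both. The outer darts of each strand remain and form a
vertex of degree 2. -/
def RemoveBigon (D D' : LinkDiagram) : Prop :=
  ∃ a b : D.Dart, D.IsCrossing a ∧ D.IsCrossing b ∧
    D.edge (D.next a) = b ∧ D.edge a = D.next b ∧ D.isOver (D.next a) = D.isOver b ∧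
    D.IsModification D' {a, D.next a, b, D.next b} D.edge
      (Function.update (Function.update (Function.update (Function.update D.next
        (D.next (D.next a)) (D.next (D.next (D.next b))))
        (D.next (D.next (D.next b))) (D.next (D.next a)))
        (D.next (D.next (D.next a))) (D.next (D.next b)))
        (D.next (D.next b)) (D.next (D.next (D.next a))))

open Classical in
/-- Third Reidemeister move. Three different crossings `A, B, C` are the corners, in
counterclockwise order, of a triangle; `a`, `b`, `c` are the darts from `A` to `B`, from `B` to
`C` and from `C` to `A`. One of the three strands passes over both others, another one under both
others, which fails only if `a, b, c` are all over or all under. After the move each strand meets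
its two crossings in the opposite order, so that on the strand through `A` and `B` the inner and
outer dart at `A` change places with the outer and inner dart at `B`; likewise for the others. -/
def SlideTriangle (D D' : LinkDiagram) : Prop :=
  ∃ a b c : D.Dart, D.IsCrossing a ∧ D.IsCrossing b ∧ D.IsCrossing c ∧
    ¬ D.next.SameCycle a b ∧ ¬ D.next.SameCycle b c ∧ ¬ D.next.SameCycle c a ∧
    D.edge a = D.next b ∧ D.edge b = D.next c ∧ D.edge c = D.next a ∧
    ¬ (D.isOver a = D.isOver b ∧ D.isOver b = D.isOver c) ∧
    ∃ s : Equiv.Perm D.Dart,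
      s = Equiv.swap (D.next (D.next a)) (D.next b) *
          Equiv.swap a (D.next (D.next (D.next b))) *
          Equiv.swap (D.next (D.next b)) (D.next c) *
          Equiv.swap b (D.next (D.next (D.next c))) *
          Equiv.swap (D.next (D.next c)) (D.next a) *
          Equiv.swap c (D.next (D.next (D.next a))) ∧
      D.IsModification D' ∅ (s * D.edge * s⁻¹) D.next

/-- One step of the equivalence of link diagrams. The Reidemeister moves are moves of planar
diagrams. -/
inductive Move : LinkDiagram → LinkDiagram → Prop
  | isomorphic {D D' : LinkDiagram} : D.Isomorphic D' → Move D D'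
  | eraseVertex {D D' : LinkDiagram} : D.EraseVertex D' → Move D D'
  | removeMonogon {D D' : LinkDiagram} :
      D.Planar → D'.Planar → D.RemoveMonogon D' → Move D D'
  | removeBigon {D D' : LinkDiagram} :
      D.Planar → D'.Planar → D.RemoveBigon D' → Move D D'
  | slideTriangle {D D' : LinkDiagram} :
      D.Planar → D'.Planar → D.SlideTriangle D' → Move D D'

/-- The diagrams represent the same link: they are related by a finite sequence of moves, each
performed in either direction. -/
def Equivalent : LinkDiagram → LinkDiagram → Prop := Relation.EqvGen Move

end LinkDiagram

/-! ## Mosaics -/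

/-- The four sides of a tile. -/
inductive Side
  | east | north | west | south
  deriving DecidableEq

namespace Side

instance : Fintype Side where
  elems := {east, north, west, south}
  complete := by intro s; cases s <;> simp

/-- The opposite side. -/
def flip : Side → Side
  | east => west
  | north => south
  | west => east
  | south => north

/-- The side that follows counterclockwise. -/
def ccw : Equiv.Perm Side where
  toFun
    | east => north
    | north => west
    | west => south
    | south => east
  invFun
    | east => south
    | north => east
    | west => north
    | south => west
  left_inv := by intro s; cases s <;> rfl
  right_inv := by intro s; cases s <;> rfl

/-- The step (row, column) to the cell beyond the given side; rows are numbered downwards. -/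
def step : Side → ℤ × ℤ
  | east => (0, 1)
  | north => (-1, 0)
  | west => (0, -1)
  | south => (1, 0)

end Side

/-- The eleven tiles: the blank tile, four quarter arcs, two straight arcs, two pairs of quarter
arcs, and two crossings. -/
inductive Tile
  | blank
  | arcEN | arcNW | arcWS | arcSE
  | horizontal | vertical
  | arcsENWS | arcsNWSE
  | crossHorizontalOver | crossVerticalOver
  deriving DecidableEq

namespace Tile

/-- An arc of a tile exchanges the two sides that it joins, a crossing turns the sides
counterclockwise. A side is fixed exactly if the tile has no connection point on it. -/
def rot (t : Tile) : Equiv.Perm Side := match t with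
  | blank => 1
  | arcEN => Equiv.swap Side.east Side.north
  | arcNW => Equiv.swap Side.north Side.west
  | arcWS => Equiv.swap Side.west Side.south
  | arcSE => Equiv.swap Side.south Side.east
  | horizontal => Equiv.swap Side.east Side.west
  | vertical => Equiv.swap Side.north Side.south
  | arcsENWS => Equiv.swap Side.east Side.north * Equiv.swap Side.west Side.south
  | arcsNWSE => Equiv.swap Side.north Side.west * Equiv.swap Side.south Side.east
  | crossHorizontalOver => Side.ccw
  | crossVerticalOver => Side.ccw

/-- The tile has a connection point on the given side. -/
def HasPoint (t : Tile) (s : Side) : Prop := t.rot s ≠ s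

/-- In a crossing tile: the given side is an end of the strand that passes over. -/
def isOver : Tile → Side → Bool
  | crossHorizontalOver, .east => true
  | crossHorizontalOver, .west => true
  | crossVerticalOver, .north => true
  | crossVerticalOver, .south => true
  | _, _ => false

theorem rot_four (t : Tile) (s : Side) : t.rot (t.rot (t.rot (t.rot s))) = s := by
  revert s; cases t <;> decide

theorem over_rot (t : Tile) (s : Side) (h : t.rot (t.rot s) ≠ s) :
    t.isOver (t.rot s) = !t.isOver s := by
  revert s; cases t <;> decide

theorem hasPoint_rot (t : Tile) (s : Side) : t.HasPoint (t.rot s) ↔ t.HasPoint s := by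
  simp [HasPoint]

end Tile

/-- An `n`-mosaic is an `n × n` matrix of tiles. -/
abbrev Mosaic (n : ℕ) : Type := Matrix (Fin n) (Fin n) Tile

namespace Mosaic

variable {n : ℕ}

/-- The tile in a cell of the plane grid; blank outside the mosaic. -/
def tileAt (M : Mosaic n) (p : ℤ × ℤ) : Tile :=
  if h : (0 ≤ p.1 ∧ p.1 < n) ∧ (0 ≤ p.2 ∧ p.2 < n) then
    M ⟨p.1.toNat, by omega⟩ ⟨p.2.toNat, by omega⟩
  else .blank

/-- Each connection point of a tile is also a connection point of the tile beyond that side; in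
particular no connection point lies on the boundary of the mosaic. A suitably connected
`n`-mosaic is an `n`-mosaic link. -/
def SuitablyConnected (M : Mosaic n) : Prop :=
  ∀ (p : ℤ × ℤ) (s : Side), (M.tileAt p).HasPoint s → (M.tileAt (p + s.step)).HasPoint s.flip

/-- A dart of a mosaic: a connection point, seen from one of the tiles on which it lies. -/
def MosaicDart (M : Mosaic n) : Type :=
  {x : (ℤ × ℤ) × Side // (M.tileAt x.1).HasPoint x.2}

theorem finite_mosaicDart (M : Mosaic n) : Finite M.MosaicDart := by
  refine Set.Finite.to_subtype (s := {x : (ℤ × ℤ) × Side | (M.tileAt x.1).HasPoint x.2}) ?_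
  refine Set.Finite.subset
    (((Set.finite_Ico (0 : ℤ) n).prod (Set.finite_Ico (0 : ℤ) n)).prod
      (Set.finite_univ (α := Side))) ?_
  rintro ⟨⟨i, j⟩, s⟩ hx
  by_cases h : (0 ≤ i ∧ i < n) ∧ (0 ≤ j ∧ j < n)
  · exact ⟨⟨h.1, h.2⟩, Set.mem_univ _⟩
  · simp [tileAt, Tile.HasPoint, Tile.rot, h] at hx

/-- The link diagram that is drawn on a suitably connected mosaic. -/
def toDiagram (M : Mosaic n) (hM : M.SuitablyConnected) : LinkDiagram where
  Dart := M.MosaicDart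
  finite_dart := M.finite_mosaicDart
  edge := Function.Involutive.toPerm
    (fun x => ⟨(x.1.1 + x.1.2.step, x.1.2.flip), hM _ _ x.2⟩) (by
      rintro ⟨⟨⟨i, j⟩, s⟩, hx⟩
      apply Subtype.ext
      cases s <;> simp [Side.step, Side.flip])
  next :=
    { toFun := fun x => ⟨(x.1.1, (M.tileAt x.1.1).rot x.1.2),
        ((M.tileAt x.1.1).hasPoint_rot x.1.2).2 x.2⟩
      invFun := fun x => ⟨(x.1.1, (M.tileAt x.1.1).rot.symm x.1.2),
        ((M.tileAt x.1.1).hasPoint_rot _).1 (by simpa using x.2)⟩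
      left_inv := fun x => Subtype.ext (by simp)
      right_inv := fun x => Subtype.ext (by simp) }
  isOver := fun x => (M.tileAt x.1.1).isOver x.1.2
  edge_edge := fun x => (Function.Involutive.toPerm_involutive _) x
  edge_ne := by
    rintro ⟨⟨⟨i, j⟩, s⟩, hx⟩ h
    have h2 : s.flip = s := congrArg (fun y => y.1.2) h
    cases s <;> simp [Side.flip] at h2
  next_ne := fun x h => x.2 (congrArg (fun y => y.1.2) h)
  next_four := fun x => Subtype.ext (Prod.ext rfl (Tile.rot_four _ _))
  over_next := fun x h => Tile.over_rot _ _ fun h2 => h (Subtype.ext (Prod.ext rfl h2))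

end Mosaic

/-- `n` is the mosaic number of the link represented by `D`: the smallest number for which some
`n`-mosaic link represents the same link. -/
def LinkDiagram.IsMosaicNumber (D : LinkDiagram) (n : ℕ) : Prop :=
  IsLeast {m : ℕ | ∃ (M : Mosaic m) (hM : M.SuitablyConnected),
    (M.toDiagram hM).Equivalent D} n

/-! ## Genus of a pair of permutations -/

namespace Hypermap

open Equiv Equiv.Perm

variable {X : Type*}

/-! A plane diagram can be drawn from top to bottom, row by row. Erasing the vertices of degree two
leaves, if every component crosses, a 4-valent map of genus zero with at most `4c` darts. While it
is being drawn, the edges that lead out of the finished part hang down in a definite order. If none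
hangs, a vertex of a new component is drawn. If one of them leads to a new vertex, that vertex is
attached at its lower end. Otherwise the hanging edges are joined among themselves; by planarity two
neighbours are joined to each other, and a cap closes them. This is `Reach`, and `reach_univ` shows
that it never gets stuck.

Planarity enters through Euler's formula for permutations. Contracting the edge from `a` to `g a`
turns `f`, `g` into `f * swap a (g a)`, `swap a (g a) * g` and keeps the face permutation `f * g`.
An edge between two vertices merges them. A loop splits its vertex, and since the genus cannot
become negative (`euler_le`), in genus zero it also splits the component: a discrete Jordan curve
theorem (`Spherical.contract_of_sameCycle`). Hence a hanging edge that starts between the two ends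
of a loop also ends between them, and an innermost pair consists of neighbours
(`SweepState.exists_neighbours`).

In tiles, `2h` hanging strands occupy the columns from `-h` to `h - 1`, and attaching a crossing or
a cap takes one row. If `r` rows are used, then `r + h` and `2h` never exceed the number of darts
drawn, so the finished tiling fits into a square of side at most `4c` (`exists_isDrawing`). Each arc
of it lies on a strand that starts at a crossing. No superfluous circle occurs, therefore, and
erasing the vertices of degree two from the diagram of the mosaic gives the original map back
(`LinkDiagram.exists_mosaic`). No Reidemeister move is needed.

What remains is a knot without crossings, which a 2-mosaic shows (`LinkDiagram.exists_circle`). Only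
there is the summand 2 of the bound used. -/

theorem sameCycle_induction {f : Perm X} {R : X → X → Prop} (hR : Equivalence R)
    (h : ∀ x, R x (f x)) {x y : X} (hxy : f.SameCycle x y) : R x y := by
  obtain ⟨i, rfl⟩ := hxy
  induction i using Int.induction_on generalizing x with
  | zero => simpa using hR.refl x
  | succ i ih =>
    rw [zpow_add, mul_apply, zpow_one]
    exact hR.trans (h x) ih
  | pred i ih =>
    rw [zpow_sub, mul_apply, zpow_one]
    refine hR.trans (hR.symm ?_) ih
    simpa using h (f⁻¹ x)

/-- The finest setoid that is coarser than `s` and identifies `a` with `b`. -/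
def joinPair (s : Setoid X) (a b : X) : Setoid X where
  r x y := s x y ∨ (s x a ∧ s b y) ∨ (s x b ∧ s a y)
  iseqv := by
    refine ⟨fun x => Or.inl (s.refl x), ?_, ?_⟩
    · rintro x y (h | ⟨h, h'⟩ | ⟨h, h'⟩)
      · exact Or.inl (s.symm h)
      · exact Or.inr (Or.inr ⟨s.symm h', s.symm h⟩)
      · exact Or.inr (Or.inl ⟨s.symm h', s.symm h⟩)
    · rintro x y z (h | ⟨h, h'⟩ | ⟨h, h'⟩) (k | ⟨k, k'⟩ | ⟨k, k'⟩)
      · exact Or.inl (s.trans h k)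
      · exact Or.inr (Or.inl ⟨s.trans h k, k'⟩)
      · exact Or.inr (Or.inr ⟨s.trans h k, k'⟩)
      · exact Or.inr (Or.inl ⟨h, s.trans h' k⟩)
      · exact Or.inr (Or.inl ⟨h, k'⟩)
      · exact Or.inl (s.trans h k')
      · exact Or.inr (Or.inr ⟨h, s.trans h' k⟩)
      · exact Or.inl (s.trans h k')
      · exact Or.inr (Or.inr ⟨h, k'⟩)

theorem le_joinPair (s : Setoid X) (a b : X) : s ≤ joinPair s a b := fun _ _ h => Or.inl h

theorem joinPair_pair (s : Setoid X) (a b : X) : joinPair s a b a b :=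
  Or.inr (Or.inl ⟨s.refl a, s.refl b⟩)

theorem joinPair_le {s t : Setoid X} {a b : X} (h : s ≤ t) (hab : t a b) : joinPair s a b ≤ t := by
  rintro x y (k | ⟨k, k'⟩ | ⟨k, k'⟩)
  · exact h k
  · exact t.trans (h k) (t.trans hab (h k'))
  · exact t.trans (h k) (t.trans (t.symm hab) (h k'))

theorem joinPair_eq {s : Setoid X} {a b : X} (h : s a b) : joinPair s a b = s :=
  le_antisymm (joinPair_le le_rfl h) (le_joinPair s a b)

theorem joinPair_congr {s t : Setoid X} {a b : X} (h : s ≤ joinPair t a b)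
    (h' : t ≤ joinPair s a b) : joinPair s a b = joinPair t a b :=
  le_antisymm (joinPair_le h (joinPair_pair t a b)) (joinPair_le h' (joinPair_pair s a b))

/-- The class of `b` is absorbed by that of `a`, so the classes other than that of `b` represent the
coarser quotient. -/
theorem card_joinPair [Finite X] {s : Setoid X} {a b : X} (h : ¬ s a b) :
    Nat.card (Quotient (joinPair s a b)) + 1 = Nat.card (Quotient s) := by
  have e : {q : Quotient s // q ≠ Quotient.mk s b} ≃ Quotient (joinPair s a b) := by
    refine Equiv.ofBijective
      (fun q => Quotient.map' (s₂ := joinPair s a b) id (fun _ _ h => Or.inl h) q.1) ⟨?_, ?_⟩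
    · rintro ⟨q, hq⟩ ⟨q', hq'⟩ hqq
      induction q using Quotient.inductionOn with | _ x
      induction q' using Quotient.inductionOn with | _ y
      have hx : ¬ s x b := fun h => hq (Quotient.sound h)
      have hy : ¬ s y b := fun h => hq' (Quotient.sound h)
      have : joinPair s a b x y := Quotient.exact hqq
      rcases this with k | ⟨k, k'⟩ | ⟨k, k'⟩
      · exact Subtype.ext (Quotient.sound k)
      · exact absurd (s.symm k') hy
      · exact absurd k hx
    · intro q
      induction q using Quotient.inductionOn with | _ x
      by_cases hx : s x b
      · exact ⟨⟨Quotient.mk s a, fun k => h (Quotient.exact k)⟩,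
          Quotient.sound (Or.inr (Or.inl ⟨s.refl a, s.symm hx⟩))⟩
      · exact ⟨⟨Quotient.mk s x, fun k => hx (Quotient.exact k)⟩, rfl⟩
  rw [← Nat.card_congr e]
  classical
  have := Fintype.ofFinite (Quotient s)
  have h0 : 0 < Fintype.card (Quotient s) := Fintype.card_pos_iff.2 ⟨Quotient.mk s b⟩
  rw [Nat.card_eq_fintype_card, Nat.card_eq_fintype_card, Fintype.card_subtype_compl,
    Fintype.card_subtype_eq]
  omega

theorem card_joinPair_le [Finite X] (s : Setoid X) (a b : X) :
    Nat.card (Quotient s) ≤ Nat.card (Quotient (joinPair s a b)) + 1 := by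
  by_cases h : s a b
  · rw [joinPair_eq h]; omega
  · rw [card_joinPair h]

/-- The number of cycles of a permutation, fixed points included. -/
noncomputable def numCycles (f : Perm X) : ℕ := Nat.card (Quotient (SameCycle.setoid f))

/-- From `a` the new permutation jumps to `f b` and then follows the old cycle of `b`, which avoids
`a`, until it reaches `b`. -/
theorem sameCycle_mul_swap [Finite X] [DecidableEq X] {f : Perm X} {a b : X}
    (h : ¬ f.SameCycle a b) : (f * swap a b).SameCycle a b := by
  set k := Function.minimalPeriod f b with hk
  have hpos : 0 < k := Function.minimalPeriod_pos_of_mem_periodicPts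
    (Function.mem_periodicPts.2 ⟨orderOf f, orderOf_pos f, by
      rw [Function.IsPeriodicPt, Function.IsFixedPt, iterate_eq_pow, pow_orderOf_eq_one]; rfl⟩)
  have main : ∀ i < k, ((f * swap a b) ^ (i + 1)) a = (f ^ (i + 1)) b := by
    intro i
    induction i with
    | zero => simp
    | succ i ih =>
      intro hi
      rw [pow_succ', mul_apply, ih (by omega), mul_apply, swap_apply_of_ne_of_ne,
        pow_succ' f (i + 1), mul_apply]
      · exact fun hh => h (SameCycle.symm ⟨(i + 1 : ℕ), by rw [zpow_natCast]; exact hh⟩)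
      · intro hh
        rw [← iterate_eq_pow] at hh
        have := Function.IsPeriodicPt.minimalPeriod_le (n := i + 1) (by omega)
          (show Function.IsPeriodicPt f (i + 1) b from hh)
        omega
  refine ⟨(k : ℕ), ?_⟩
  obtain ⟨j, hj⟩ : ∃ j, k = j + 1 := ⟨k - 1, by omega⟩
  rw [zpow_natCast, hj, main j (by omega), ← hj, ← iterate_eq_pow]
  exact Function.iterate_minimalPeriod

/-- Let `k` be the first exponent with `(f ^ k) b = a`. From `a` the new permutation jumps to `f b`
and runs to `(f ^ k) b = a` again, so it never meets `b`. -/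
theorem not_sameCycle_mul_swap [Finite X] [DecidableEq X] {f : Perm X} {a b : X} (hab : a ≠ b)
    (h : f.SameCycle a b) : ¬ (f * swap a b).SameCycle a b := by
  have hex : ∃ k, (f ^ k) b = a := by
    obtain ⟨i, -, hi⟩ := h.symm.exists_pow_eq'
    exact ⟨i, hi⟩
  classical
  set k := Nat.find hex with hk
  have hka : (f ^ k) b = a := Nat.find_spec hex
  have hmin : ∀ j < k, (f ^ j) b ≠ a := fun j hj => Nat.find_min hex hj
  have hkpos : 0 < k := Nat.pos_of_ne_zero fun h0 => hab (by rw [h0] at hka; simpa using hka.symm)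
  have hnb : ∀ j, 0 < j → j ≤ k → (f ^ j) b ≠ b := by
    intro j hj hjk hjb
    refine hmin (k - j) (by omega) ?_
    have : (f ^ k) b = (f ^ (k - j)) ((f ^ j) b) := by rw [← mul_apply, ← pow_add]; congr 2; omega
    rw [hjb] at this
    rw [← this, hka]
  intro hs
  obtain ⟨n, -, hn⟩ := hs.exists_pow_eq'
  have main : ∀ n, ∃ j, 0 < j ∧ j ≤ k ∧ ((f * swap a b) ^ n) a = (f ^ j) b := by
    intro n
    induction n with
    | zero => exact ⟨k, hkpos, le_rfl, by simpa using hka.symm⟩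
    | succ n ih =>
      obtain ⟨j, hj, hjk, e⟩ := ih
      rw [pow_succ', mul_apply, e, mul_apply]
      rcases hjk.eq_or_lt with rfl | hlt
      · exact ⟨1, one_pos, hkpos, by rw [hka]; simp⟩
      · refine ⟨j + 1, by omega, hlt, ?_⟩
        rw [swap_apply_of_ne_of_ne (hmin j hlt) (hnb j hj hjk), pow_succ', mul_apply]
  obtain ⟨j, hj, hjk, e⟩ := main n
  exact hnb j hj hjk (e.symm.trans hn)

theorem sameCycle_le_joinPair [DecidableEq X] (f : Perm X) (a b : X) :
    SameCycle.setoid (f * swap a b) ≤ joinPair (SameCycle.setoid f) a b := by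
  intro x y h
  refine sameCycle_induction (joinPair (SameCycle.setoid f) a b).iseqv (fun x => ?_) h
  have h1 (z : X) : SameCycle.setoid f z (f z) := sameCycle_apply_right.2 (SameCycle.refl f z)
  by_cases hxa : x = a
  · subst hxa
    exact Or.inr (Or.inl ⟨Setoid.refl' _ _, by simpa using h1 b⟩)
  by_cases hxb : x = b
  · subst hxb
    exact Or.inr (Or.inr ⟨Setoid.refl' _ _, by simpa using h1 a⟩)
  · exact Or.inl (by simpa [swap_apply_of_ne_of_ne hxa hxb] using h1 x)

/-- The two permutations differ only at `a` and `b`, so their cycle partitions agree once these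
points are identified. If `a ≠ b`, exactly one of the partitions separates them, which is why the
numbers of cycles differ by one. -/
theorem joinPair_mul_swap [DecidableEq X] (f : Perm X) (a b : X) :
    joinPair (SameCycle.setoid (f * swap a b)) a b = joinPair (SameCycle.setoid f) a b :=
  joinPair_congr (sameCycle_le_joinPair f a b)
    (by simpa using sameCycle_le_joinPair (f * swap a b) a b)

theorem numCycles_mul_swap_of_not_sameCycle [Finite X] [DecidableEq X] {f : Perm X} {a b : X}
    (h : ¬ f.SameCycle a b) : numCycles (f * swap a b) + 1 = numCycles f := by
  rw [numCycles, numCycles, ← card_joinPair (s := SameCycle.setoid f) h, ← joinPair_mul_swap,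
    joinPair_eq (s := SameCycle.setoid (f * swap a b)) (sameCycle_mul_swap h)]

theorem numCycles_mul_swap_of_sameCycle [Finite X] [DecidableEq X] {f : Perm X} {a b : X}
    (hab : a ≠ b) (h : f.SameCycle a b) : numCycles (f * swap a b) = numCycles f + 1 := by
  rw [← numCycles_mul_swap_of_not_sameCycle (not_sameCycle_mul_swap hab h)]
  simp

theorem numCycles_swap_mul_of_sameCycle [Finite X] [DecidableEq X] {f : Perm X} {a b : X}
    (hab : a ≠ b) (h : f.SameCycle a b) : numCycles (swap a b * f) = numCycles f + 1 := by
  rw [swap_mul_eq_mul_swap]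
  refine numCycles_mul_swap_of_sameCycle (by simpa using hab) ?_
  rw [← sameCycle_apply_left, ← sameCycle_apply_right]
  simpa using h

/-- The classes of points that are connected by two permutations. -/
def connected (f g : Perm X) : Setoid X := Relation.EqvGen.setoid fun x y => y = f x ∨ y = g x

/-- The number of orbits of the group generated by two permutations. -/
noncomputable def numPieces (f g : Perm X) : ℕ := Nat.card (Quotient (connected f g))

theorem connected_left (f g : Perm X) (x : X) : connected f g x (f x) :=
  Relation.EqvGen.rel _ _ (Or.inl rfl)

theorem connected_right (f g : Perm X) (x : X) : connected f g x (g x) :=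
  Relation.EqvGen.rel _ _ (Or.inr rfl)

theorem connected_le {f g : Perm X} {s : Setoid X} (hf : ∀ x, s x (f x)) (hg : ∀ x, s x (g x)) :
    connected f g ≤ s := by
  intro x y h
  induction h with
  | rel x y h => rcases h with rfl | rfl; exacts [hf x, hg x]
  | refl x => exact s.refl x
  | symm x y _ ih => exact s.symm ih
  | trans x y z _ _ ih ih' => exact s.trans ih ih'

theorem sameCycle_connected {f g : Perm X} {x y : X} (h : f.SameCycle x y) : connected f g x y :=
  sameCycle_induction (connected f g).iseqv (connected_left f g) h

theorem connected_le_joinPair [DecidableEq X] (f g : Perm X) (a b : X) :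
    connected (f * swap a b) (swap a b * g) ≤ joinPair (connected f g) a b := by
  refine connected_le (fun x => ?_) fun x => ?_
  · by_cases hxa : x = a
    · subst hxa
      exact Or.inr (Or.inl ⟨Setoid.refl' _ _, by simpa using connected_left f g b⟩)
    by_cases hxb : x = b
    · subst hxb
      exact Or.inr (Or.inr ⟨Setoid.refl' _ _, by simpa using connected_left f g a⟩)
    · exact Or.inl (by simpa [swap_apply_of_ne_of_ne hxa hxb] using connected_left f g x)
  · have h := connected_right f g x
    rw [mul_apply]
    by_cases hxa : g x = a
    · rw [hxa] at h ⊢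
      exact Or.inr (Or.inl ⟨h, by simp⟩)
    by_cases hxb : g x = b
    · rw [hxb] at h ⊢
      exact Or.inr (Or.inr ⟨h, by simp⟩)
    · exact Or.inl (by simpa [swap_apply_of_ne_of_ne hxa hxb] using h)

theorem joinPair_connected [DecidableEq X] (f g : Perm X) (a b : X) :
    joinPair (connected (f * swap a b) (swap a b * g)) a b = joinPair (connected f g) a b :=
  joinPair_congr (connected_le_joinPair f g a b)
    (by simpa [← mul_assoc] using connected_le_joinPair (f * swap a b) (swap a b * g) a b)

/-- Euler's formula for genus zero, for the hypermap with vertices `f` and hyperedges `g`. -/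
def Spherical (f g : Perm X) : Prop :=
  numCycles f + numCycles g + numCycles (f * g) = Nat.card X + 2 * numPieces f g

theorem numCycles_one [Finite X] : numCycles (1 : Perm X) = Nat.card X := by
  refine (Nat.card_congr (Equiv.ofBijective (Quotient.mk (SameCycle.setoid (1 : Perm X)))
    ⟨fun x y h => ?_, Quotient.mk_surjective⟩)).symm
  have : (1 : Perm X).SameCycle x y := Quotient.exact h
  simpa using this

theorem numPieces_one (f : Perm X) : numPieces f 1 = numCycles f := by
  have : connected f 1 = SameCycle.setoid f :=
    le_antisymm (connected_le (fun x => sameCycle_apply_right.2 (SameCycle.refl f x))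
      fun x => SameCycle.refl f x) fun _ _ => sameCycle_connected
  rw [numPieces, numCycles, this]

/-- Both factors receive the same transposition so that the faces survive a contraction. -/
theorem mul_swap_mul_swap_mul [DecidableEq X] (f g : Perm X) (a b : X) :
    (f * swap a b) * (swap a b * g) = f * g := by
  rw [mul_assoc, ← mul_assoc (swap a b), swap_mul_self, one_mul]

/-! ### Contraction of an edge, and the genus -/

section Contract

variable [Finite X] [DecidableEq X] {f g : Perm X} {a : X}

/-- The point `a` is cut out of its cycle of `g` and becomes a fixed point. -/
theorem numCycles_contract (h : g a ≠ a) :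
    numCycles (swap a (g a) * g) = numCycles g + 1 :=
  numCycles_swap_mul_of_sameCycle h.symm (sameCycle_apply_right.2 (SameCycle.refl g a))

/-- The merged cycle keeps `a` and `g a` connected, so identifying them changes the components
neither before nor after. -/
theorem numPieces_contract_of_not_sameCycle (hs : ¬ f.SameCycle a (g a)) :
    numPieces (f * swap a (g a)) (swap a (g a) * g) = numPieces f g := by
  have h1 := joinPair_connected f g a (g a)
  rw [joinPair_eq (sameCycle_connected (sameCycle_mul_swap hs)),
    joinPair_eq (connected_right f g a)] at h1
  rw [numPieces, numPieces, h1]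

theorem numPieces_contract_le (f g : Perm X) (a : X) :
    numPieces (f * swap a (g a)) (swap a (g a) * g) ≤ numPieces f g + 1 := by
  have h := card_joinPair_le (connected (f * swap a (g a)) (swap a (g a) * g)) a (g a)
  rwa [joinPair_connected, joinPair_eq (connected_right f g a)] at h

/-- The genus is nonnegative. -/
theorem euler_le (f g : Perm X) :
    numCycles f + numCycles g + numCycles (f * g) ≤ Nat.card X + 2 * numPieces f g := by
  have := Fintype.ofFinite X
  induction hn : g.support.card using Nat.strong_induction_on generalizing f g with
  | _ n ih
  by_cases hg : g = 1
  · subst hg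
    rw [mul_one, numCycles_one, numPieces_one]; omega
  obtain ⟨a, ha⟩ : ∃ a, g a ≠ a := by
    by_contra! hc
    exact hg (Equiv.ext hc)
  have h := ih _ (hn ▸ card_support_swap_mul ha) (f * swap a (g a)) (swap a (g a) * g) rfl
  rw [mul_swap_mul_swap_mul, numCycles_contract ha] at h
  -- For a loop the left side grows by two and the number of pieces by at most one. For an edge
  -- between different vertices, one vertex is lost, one cycle of `g` is gained, and the pieces
  -- remain.
  by_cases hs : f.SameCycle a (g a)
  · rw [numCycles_mul_swap_of_sameCycle ha.symm hs] at h
    have := numPieces_contract_le f g a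
    omega
  · have h1 := numCycles_mul_swap_of_not_sameCycle hs
    rw [numPieces_contract_of_not_sameCycle hs] at h
    omega

theorem Spherical.contract_of_not_sameCycle (h : Spherical f g) (ha : g a ≠ a)
    (hs : ¬ f.SameCycle a (g a)) : Spherical (f * swap a (g a)) (swap a (g a) * g) := by
  have h1 := numCycles_mul_swap_of_not_sameCycle hs
  rw [Spherical] at h ⊢
  rw [mul_swap_mul_swap_mul, numCycles_contract ha, numPieces_contract_of_not_sameCycle hs]
  omega

/-- The loop adds two to the left side of Euler's formula. As `euler_le` still holds afterwards, the
number of pieces must grow by exactly one, which is impossible if `a` and `g a` stay connected. -/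
theorem Spherical.contract_of_sameCycle (h : Spherical f g) (ha : g a ≠ a)
    (hs : f.SameCycle a (g a)) : Spherical (f * swap a (g a)) (swap a (g a) * g) ∧
      ¬ connected (f * swap a (g a)) (swap a (g a) * g) a (g a) := by
  have h1 := numCycles_mul_swap_of_sameCycle ha.symm hs
  have h2 := numPieces_contract_le f g a
  have h3 := euler_le (f * swap a (g a)) (swap a (g a) * g)
  rw [mul_swap_mul_swap_mul, numCycles_contract ha] at h3
  rw [Spherical] at h ⊢
  rw [mul_swap_mul_swap_mul, numCycles_contract ha]
  refine ⟨by omega, fun hc => ?_⟩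
  have h4 := joinPair_connected f g a (g a)
  rw [joinPair_eq hc, joinPair_eq (connected_right f g a)] at h4
  rw [numPieces, h4, ← numPieces] at h3
  omega

end Contract

end Hypermap

/-! ### Sweeping a spherical four-valent map -/

namespace Hypermap

open Equiv Equiv.Perm

variable {X : Type*}

/-- `Reach σ e L S`: sweeping a plane map with vertex rotation `σ` of order four and edges `e`, one
may have drawn the vertices with darts in `S` so that the edges from `L`, in this order, hang down.
A step draws a first vertex of a new component, or a vertex at the end of a hanging edge, or joins
two neighbouring hanging edges. -/
inductive Reach [DecidableEq X] (σ e : Perm X) : List X → Finset X → Prop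
  | nil : Reach σ e [] ∅
  | start {S : Finset X} {d : X} : Reach σ e [] S → d ∉ S →
      Reach σ e [d, σ d, σ (σ d), σ (σ (σ d))] (S ∪ {d, σ d, σ (σ d), σ (σ (σ d))})
  | attach {S : Finset X} {A B : List X} {a b : X} : Reach σ e (A ++ a :: B) S → e a = b → b ∉ S →
      Reach σ e (A ++ σ b :: σ (σ b) :: σ (σ (σ b)) :: B)
        (S ∪ {b, σ b, σ (σ b), σ (σ (σ b))})
  | cap {S : Finset X} {A B : List X} {a b : X} : Reach σ e (A ++ a :: b :: B) S → e a = b →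
      Reach σ e (A ++ B) S

/-- The invariant of the sweep: after the contraction of the edges drawn so far the map has vertices
`f` and edges `g`, and `Z` is a part of a cycle of `f` that contains the hanging edges. -/
structure SweepState [DecidableEq X] (σ e : Perm X) (L : List X) (S : Finset X) (Z : List X)
    (f g : Perm X) : Prop where
  reach : Reach σ e L S
  spherical : Spherical f g
  f_eq : ∀ x ∉ S, f x = σ x
  g_eq : ∀ x ∉ S, g x = e x
  g_or : ∀ x, g x = x ∨ g x = e x
  L_eq : L = Z.filter fun x => g x ≠ x
  nodup : Z.Nodup
  chain : Z.IsChain fun x y => f x = y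
  live_mem : ∀ x ∈ S, g x ≠ x → x ∈ Z
  subset : ∀ x ∈ Z, x ∈ S

theorem connected_of_isChain {f g : Perm X} {a : X} {Z : List X}
    (h : (a :: Z).IsChain fun x y => f x = y) {x : X} (hx : x ∈ a :: Z) : connected f g a x := by
  induction Z generalizing a with
  | nil => simp only [List.mem_singleton] at hx; subst hx; exact Setoid.refl' _ _
  | cons b Z ih =>
    rw [List.isChain_cons_cons] at h
    rcases List.mem_cons.1 hx with rfl | hx
    · exact Setoid.refl' _ _
    · refine Setoid.trans' _ ?_ (ih h.2 hx)
      rw [← h.1]; exact connected_left f g a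

theorem sameCycle_of_isChain {f : Perm X} {a : X} {Z : List X}
    (h : (a :: Z).IsChain fun x y => f x = y) {x : X} (hx : x ∈ a :: Z) : f.SameCycle a x := by
  have h1 := connected_of_isChain (g := 1) h hx
  exact connected_le (s := SameCycle.setoid f)
    (fun x => sameCycle_apply_right.2 (SameCycle.refl f x)) (fun x => SameCycle.refl f x) h1

theorem isChain_congr {f f' : Perm X} {Z : List X} (h : Z.IsChain fun x y => f x = y)
    (hf : ∀ x ∈ Z, f' x = f x) : Z.IsChain fun x y => f' x = y := by
  induction Z with
  | nil => exact List.IsChain.nil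
  | cons a Z ih =>
    cases Z with
    | nil => exact List.IsChain.singleton _
    | cons b Z =>
      rw [List.isChain_cons_cons] at h ⊢
      exact ⟨by rw [hf a (by simp), h.1], ih h.2 fun x hx => hf x (List.mem_cons_of_mem _ hx)⟩

/-- A chain, followed by an arbitrary continuation of its last element. -/
theorem isChain_congr_append {f f' : Perm X} {A : List X} {b : X}
    (h : (A ++ [b]).IsChain fun x y => f x = y) (hf : ∀ x ∈ A, f' x = f x) :
    (A ++ [b]).IsChain fun x y => f' x = y := by
  induction A with
  | nil => exact List.IsChain.singleton _
  | cons a A ih =>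
    have hA := fun x hx => hf x (List.mem_cons_of_mem _ hx)
    have ha := hf a (by simp)
    cases A with
    | nil =>
      simp only [List.cons_append, List.nil_append, List.isChain_cons_cons] at h ⊢
      exact ⟨by rw [ha, h.1], List.IsChain.singleton _⟩
    | cons c A =>
      simp only [List.cons_append, List.isChain_cons_cons] at h ⊢ ih
      exact ⟨by rw [ha, h.1], ih h.2 hA⟩

/-- The vertices have degree four, and the edges join two darts. -/
structure FourValent (σ e : Perm X) : Prop where
  edge_edge : ∀ x, e (e x) = x
  edge_ne : ∀ x, e x ≠ x
  four : ∀ x, σ (σ (σ (σ x))) = x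
  ne_one : ∀ x, σ x ≠ x
  ne_two : ∀ x, σ (σ x) ≠ x

theorem FourValent.ne_three {σ e : Perm X} (h : FourValent σ e) (x : X) : σ (σ (σ x)) ≠ x := by
  intro hx
  have := h.four x
  rw [hx] at this
  exact h.ne_one x this

theorem filter_ne_cons_pos [DecidableEq X] {g : Perm X} {x : X} {B : List X} (h : g x ≠ x) :
    (x :: B).filter (fun x => g x ≠ x) = x :: B.filter fun x => g x ≠ x :=
  List.filter_cons_of_pos (by simpa using h)

theorem filter_ne_cons_neg [DecidableEq X] {g : Perm X} {x : X} {B : List X} (h : ¬ g x ≠ x) :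
    (x :: B).filter (fun x => g x ≠ x) = B.filter fun x => g x ≠ x :=
  List.filter_cons_of_neg (by simpa using h)

section Orbit

variable [DecidableEq X] {σ e : Perm X} {S : Finset X} {b : X}

theorem disjoint_orbit (hS : ∀ x, σ x ∈ S → x ∈ S) (hb : b ∉ S) {y : X}
    (hy : y ∈ S) : y ∉ ({b, σ b, σ (σ b), σ (σ (σ b))} : Finset X) := by
  simp only [Finset.mem_insert, Finset.mem_singleton, not_or]
  refine ⟨?_, ?_, ?_, ?_⟩ <;> rintro rfl
  · exact hb hy
  · exact hb (hS _ hy)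
  · exact hb (hS _ (hS _ hy))
  · exact hb (hS _ (hS _ (hS _ hy)))

theorem card_orbit (hσ : FourValent σ e) :
    ({b, σ b, σ (σ b), σ (σ (σ b))} : Finset X).card = 4 := by
  have i1 := hσ.ne_one
  have i2 := hσ.ne_two
  have i3 := hσ.ne_three
  rw [Finset.card_insert_of_notMem, Finset.card_insert_of_notMem,
    Finset.card_insert_of_notMem, Finset.card_singleton]
  all_goals simp only [Finset.mem_insert, Finset.mem_singleton, not_or,
    EmbeddingLike.apply_eq_iff_eq]
  · exact (i1 _).symm
  · exact ⟨(i1 _).symm, (i2 _).symm⟩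
  · exact ⟨(i1 _).symm, (i2 _).symm, (i3 _).symm⟩

theorem card_union_orbit (hσ : FourValent σ e) (hS : ∀ x, σ x ∈ S → x ∈ S) (hb : b ∉ S) :
    (S ∪ {b, σ b, σ (σ b), σ (σ (σ b))}).card = S.card + 4 := by
  rw [Finset.card_union_of_disjoint, card_orbit hσ]
  exact Finset.disjoint_left.2 fun y hy => disjoint_orbit hS hb hy

end Orbit

section Sweep

variable [DecidableEq X] {σ e : Perm X}

theorem Reach.rotation_mem (hσ : FourValent σ e) {L : List X} {S : Finset X}
    (h : Reach σ e L S) : ∀ x ∈ S, σ x ∈ S := by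
  induction h with
  | nil => simp
  | start _ _ ih =>
    intro x hx
    simp only [Finset.mem_union, Finset.mem_insert, Finset.mem_singleton] at hx ⊢
    rcases hx with hx | rfl | rfl | rfl | rfl
    · exact Or.inl (ih x hx)
    all_goals simp [hσ.four]
  | attach _ _ _ ih =>
    intro x hx
    simp only [Finset.mem_union, Finset.mem_insert, Finset.mem_singleton] at hx ⊢
    rcases hx with hx | rfl | rfl | rfl | rfl
    · exact Or.inl (ih x hx)
    all_goals simp [hσ.four]
  | cap _ _ ih => exact ih

theorem Reach.mem_of_rotation_mem (hσ : FourValent σ e) {L : List X} {S : Finset X}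
    (h : Reach σ e L S) {x : X} (hx : σ x ∈ S) : x ∈ S := by
  have := h.rotation_mem hσ _ (h.rotation_mem hσ _ (h.rotation_mem hσ _ hx))
  rwa [hσ.four] at this

/-- A dart counts as live while `g` moves it; contracting an edge makes exactly its two ends dead.
-/
theorem swap_mul_fixed_iff (hσ : FourValent σ e) {g : Perm X} (hg : ∀ x, g x = x ∨ g x = e x)
    {a : X} (ha : g a ≠ a) (x : X) :
    (swap a (g a) * g) x ≠ x ↔ g x ≠ x ∧ x ≠ a ∧ x ≠ g a := by
  have hga : g a = e a := (hg a).resolve_left ha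
  have hgga : g (g a) = a := by
    rcases hg (g a) with h | h
    · exact absurd (g.injective h) ha
    · rw [h, hga, hσ.edge_edge]
  by_cases h1 : x = a
  · subst h1; simp
  by_cases h2 : x = g a
  · subst h2; simp [hgga]
  · have h3 : g x ≠ g a := fun h => h1 (g.injective h)
    have h4 : g x ≠ a := fun h => h2 (g.injective (h.trans hgga.symm))
    simp [h1, h2, swap_apply_of_ne_of_ne h4 h3]

theorem swap_mul_apply_of_ne (hσ : FourValent σ e) {g : Perm X}
    (hg : ∀ x, g x = x ∨ g x = e x) {a : X} (ha : g a ≠ a) {x : X} (h1 : x ≠ a) (h2 : x ≠ g a) :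
    (swap a (g a) * g) x = g x := by
  have hga : g a = e a := (hg a).resolve_left ha
  have hgga : g (g a) = a := by
    rcases hg (g a) with h | h
    · exact absurd (g.injective h) ha
    · rw [h, hga, hσ.edge_edge]
  have h3 : g x ≠ g a := fun h => h1 (g.injective h)
  have h4 : g x ≠ a := fun h => h2 (g.injective (h.trans hgga.symm))
  simp [swap_apply_of_ne_of_ne h4 h3]

theorem swap_mul_or (hσ : FourValent σ e) {g : Perm X} (hg : ∀ x, g x = x ∨ g x = e x)
    {a : X} (ha : g a ≠ a) (x : X) :
    (swap a (g a) * g) x = x ∨ (swap a (g a) * g) x = e x := by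
  by_cases h : (swap a (g a) * g) x = x
  · exact Or.inl h
  · obtain ⟨-, h1, h2⟩ := (swap_mul_fixed_iff hσ hg ha x).1 h
    rw [swap_mul_apply_of_ne hσ hg ha h1 h2]
    exact hg x

namespace SweepState

variable {L Z : List X} {S : Finset X} {f g : Perm X}

/-- When nothing hangs, every drawn dart is dead, so the old list `Z` can be dropped and the new
vertex supplies another one. No edge is contracted. -/
theorem start_step (hσ : FourValent σ e) (h : SweepState σ e [] S Z f g) {d : X} (hd : d ∉ S) :
    ∃ Z', SweepState σ e [d, σ d, σ (σ d), σ (σ (σ d))]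
      (S ∪ {d, σ d, σ (σ d), σ (σ (σ d))}) Z' f g := by
  have h1 : σ d ∉ S := fun k => hd (h.reach.mem_of_rotation_mem hσ k)
  have h2 : σ (σ d) ∉ S := fun k => h1 (h.reach.mem_of_rotation_mem hσ k)
  have h3 : σ (σ (σ d)) ∉ S := fun k => h2 (h.reach.mem_of_rotation_mem hσ k)
  refine ⟨[d, σ d, σ (σ d), σ (σ (σ d))], h.reach.start hd, h.spherical, ?_, ?_, h.g_or, ?_, ?_, ?_,
    ?_, ?_⟩
  · exact fun x hx => h.f_eq x fun k => hx (Finset.mem_union_left _ k)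
  · exact fun x hx => h.g_eq x fun k => hx (Finset.mem_union_left _ k)
  · rw [List.filter_eq_self.2]
    intro x hx
    have hxS : x ∉ S := by
      simp only [List.mem_cons, List.not_mem_nil, or_false] at hx
      rcases hx with rfl | rfl | rfl | rfl <;> assumption
    simpa [h.g_eq x hxS] using hσ.edge_ne x
  · have i1 := hσ.ne_one
    have i2 := hσ.ne_two
    have i3 := hσ.ne_three
    simp only [List.nodup_cons, List.mem_cons, List.not_mem_nil, or_false, not_or, not_false_eq_true,
      List.nodup_nil, and_true, EmbeddingLike.apply_eq_iff_eq]
    exact ⟨⟨(i1 d).symm, (i2 d).symm, (i3 d).symm⟩, ⟨(i1 _).symm, (i2 _).symm⟩, (i1 _).symm⟩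
  · simp [List.isChain_cons_cons, h.f_eq _ hd, h.f_eq _ h1, h.f_eq _ h2]
  · intro x hx hgx
    rcases Finset.mem_union.1 hx with hx | hx
    · have := h.live_mem x hx hgx
      have hm : x ∈ Z.filter fun x => g x ≠ x := List.mem_filter.2 ⟨this, by simpa using hgx⟩
      rw [← h.L_eq] at hm
      simp at hm
    · simpa using hx
  · intro x hx
    refine Finset.mem_union_right _ ?_
    simpa using hx

theorem g_ne (hσ : FourValent σ e) (h : SweepState σ e L S Z f g) {x : X} (hx : x ∉ S) :
    g x ≠ x := by
  rw [h.g_eq x hx]; exact hσ.edge_ne x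

theorem filter_congr_of_not_mem {a b : X} {g' : Perm X}
    (hg : ∀ x, g' x ≠ x ↔ g x ≠ x ∧ x ≠ a ∧ x ≠ b) {A : List X} (ha : a ∉ A) (hb : b ∉ A) :
    A.filter (fun x => g' x ≠ x) = A.filter fun x => g x ≠ x := by
  refine List.filter_congr fun x hx => ?_
  have h1 : x ≠ a := fun h => ha (h ▸ hx)
  have h2 : x ≠ b := fun h => hb (h ▸ hx)
  have := hg x
  simp only [h1, h2, ne_eq, not_false_eq_true, and_true] at this
  simp [this]

/-- Outside `S` the permutation `f` is still `σ`, and the complement of `S` is closed under `σ`. -/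
theorem not_sameCycle [Finite X] (hσ : FourValent σ e) (h : SweepState σ e L S Z f g) {a b : X}
    (ha : a ∈ S) (hb : b ∉ S) : ¬ f.SameCycle a b := by
  intro hs
  obtain ⟨i, -, hi⟩ := hs.symm.exists_pow_eq'
  have : ∀ i : ℕ, (f ^ i) b ∉ S := by
    intro i
    induction i with
    | zero => simpa using hb
    | succ i ih =>
      rw [pow_succ', mul_apply, h.f_eq _ ih]
      exact fun k => ih (h.reach.mem_of_rotation_mem hσ k)
  exact this i (hi ▸ ha)

/-- The edge joins the cycle of the drawn part to an untouched vertex, so its contraction is a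
merger and preserves genus zero. -/
theorem attach_step [Finite X] (hσ : FourValent σ e) (h : SweepState σ e L S Z f g) {a b : X}
    (ha : a ∈ L) (hab : e a = b) (hb : b ∉ S) :
    ∃ L' Z' f' g', L'.length = L.length + 2 ∧
      SweepState σ e L' (S ∪ {b, σ b, σ (σ b), σ (σ (σ b))}) Z' f' g' := by
  have hLZ : a ∈ Z ∧ g a ≠ a := by
    have := h.L_eq ▸ ha
    simpa using this
  obtain ⟨haZ, hga⟩ := hLZ
  have haS := h.subset a haZ
  have hgab : g a = b := by rw [← hab]; exact (h.g_or a).resolve_left hga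
  have h1 : σ b ∉ S := fun k => hb (h.reach.mem_of_rotation_mem hσ k)
  have h2 : σ (σ b) ∉ S := fun k => h1 (h.reach.mem_of_rotation_mem hσ k)
  have h3 : σ (σ (σ b)) ∉ S := fun k => h2 (h.reach.mem_of_rotation_mem hσ k)
  have hneS {x : X} (hx : x ∉ S) : x ≠ a := fun k => hx (k ▸ haS)
  have hbne : b ≠ a := hneS hb
  obtain ⟨A, B, rfl⟩ := List.append_of_mem haZ
  have hbZ {x : X} (hx : x ∈ A ++ a :: B) : x ≠ b := fun k => hb (k ▸ h.subset x hx)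
  have hnd := h.nodup
  rw [List.nodup_append, List.nodup_cons] at hnd
  obtain ⟨ndA, ⟨haB, ndB⟩, hdisj⟩ := hnd
  have haA : a ∉ A := fun k => hdisj a k a (by simp) rfl
  have hbA : b ∉ A := fun k => hbZ (by simp [k]) rfl
  have hbB : b ∉ B := fun k => hbZ (by simp [k]) rfl
  have hf' {x : X} (hx : x ≠ a) (hx' : x ≠ b) : (f * swap a b) x = f x := by
    simp [swap_apply_of_ne_of_ne hx hx']
  have hg' : ∀ x, (swap a b * g) x ≠ x ↔ g x ≠ x ∧ x ≠ a ∧ x ≠ b := by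
    have := swap_mul_fixed_iff hσ h.g_or hga
    rwa [hgab] at this
  have hnotA {x : X} (hx : x ∉ S) : x ∉ A := fun k => hx (h.subset x (by simp [k]))
  have hnotB {x : X} (hx : x ∉ S) : x ∉ B := fun k => hx (h.subset x (by simp [k]))
  have i1 := hσ.ne_one
  have i2 := hσ.ne_two
  have i3 := hσ.ne_three
  have hL : L = A.filter (fun x => g x ≠ x) ++ a :: B.filter fun x => g x ≠ x := by
    rw [h.L_eq, List.filter_append, List.filter_cons_of_pos (by simpa using hga)]
  -- The merged cycle goes from `a` to `f b = σ b` and from `b` to the former successor of `a`. Both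
  -- `a` and `b` stay in the list as dead darts, so that it remains a chain.
  refine ⟨A.filter (fun x => g x ≠ x) ++ σ b :: σ (σ b) :: σ (σ (σ b)) ::
    B.filter (fun x => g x ≠ x), A ++ a :: σ b :: σ (σ b) :: σ (σ (σ b)) :: b :: B,
    f * swap a b, swap a b * g, ?_, ?_⟩
  · rw [hL]; simp only [List.length_append, List.length_cons]; omega
  refine ⟨(hL ▸ h.reach).attach hab hb, ?_, ?_, ?_, ?_, ?_, ?_, ?_, ?_, ?_⟩
  · have := h.spherical.contract_of_not_sameCycle hga
      (by rw [hgab]; exact h.not_sameCycle hσ haS hb)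
    rwa [hgab] at this
  · intro x hx
    simp only [Finset.mem_union, Finset.mem_insert, not_or] at hx
    rw [hf' (hneS hx.1) hx.2.1, h.f_eq x hx.1]
  · intro x hx
    simp only [Finset.mem_union, Finset.mem_insert, not_or] at hx
    have := swap_mul_apply_of_ne hσ h.g_or hga (hneS hx.1) (by rw [hgab]; exact hx.2.1)
    rw [hgab] at this
    rw [this, h.g_eq x hx.1]
  · have := swap_mul_or hσ h.g_or hga
    rwa [hgab] at this
  · have live {x : X} (hx : x ∉ S) (hxb : x ≠ b) : (swap a b * g) x ≠ x := by
      rw [hg']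
      exact ⟨h.g_ne hσ hx, hneS hx, hxb⟩
    have dead {x : X} (hx : x = a ∨ x = b) : ¬ (swap a b * g) x ≠ x := by
      rw [hg']
      tauto
    rw [List.filter_append, filter_ne_cons_neg (dead (Or.inl rfl)),
      filter_ne_cons_pos (live h1 (i1 b)), filter_ne_cons_pos (live h2 (i2 b)),
      filter_ne_cons_pos (live h3 (i3 b)), filter_ne_cons_neg (dead (Or.inr rfl)),
      filter_congr_of_not_mem hg' haA hbA, filter_congr_of_not_mem hg' haB hbB]
  · rw [List.nodup_append]
    refine ⟨ndA, ?_, ?_⟩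
    · simp only [List.nodup_cons, List.mem_cons, not_or, EmbeddingLike.apply_eq_iff_eq]
      exact ⟨⟨(hneS h1).symm, (hneS h2).symm, (hneS h3).symm, hbne.symm, haB⟩,
        ⟨(i1 _).symm, (i2 _).symm, i1 _, hnotB h1⟩, ⟨(i1 _).symm, i2 _, hnotB h2⟩,
        ⟨i3 _, hnotB h3⟩, hbB, ndB⟩
    · intro x hx y hy hxy
      subst hxy
      simp only [List.mem_cons] at hy
      rcases hy with rfl | rfl | rfl | rfl | rfl | hy
      · exact haA hx
      · exact hnotA h1 hx
      · exact hnotA h2 hx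
      · exact hnotA h3 hx
      · exact hbA hx
      · exact hdisj x hx x (by simp [hy]) rfl
  · have hch := h.chain
    rw [List.isChain_split] at hch ⊢
    refine ⟨isChain_congr_append hch.1 fun x hx => hf' (fun k => haA (k ▸ hx))
      fun k => hbA (k ▸ hx), ?_⟩
    simp only [List.isChain_cons_cons]
    refine ⟨by simp [h.f_eq b hb], by rw [hf' (hneS h1) (i1 b), h.f_eq _ h1],
      by rw [hf' (hneS h2) (i2 b), h.f_eq _ h2],
      by rw [hf' (hneS h3) (i3 b), h.f_eq _ h3, hσ.four], ?_⟩
    cases B with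
    | nil => exact List.IsChain.singleton _
    | cons c B =>
      rw [List.isChain_cons_cons] at hch ⊢
      exact ⟨by simpa using hch.2.1, isChain_congr hch.2.2 fun x hx =>
        hf' (fun k => haB (k ▸ hx)) fun k => hbB (k ▸ hx)⟩
  · intro x hx hxg
    obtain ⟨hxg, hxa, hxb⟩ := (hg' x).1 hxg
    rcases Finset.mem_union.1 hx with hx | hx
    · have := h.live_mem x hx hxg
      simp only [List.mem_append, List.mem_cons] at this ⊢
      tauto
    · simp only [Finset.mem_insert, Finset.mem_singleton, List.mem_append, List.mem_cons] at hx ⊢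
      tauto
  · intro x hx
    have := h.subset x
    simp only [Finset.mem_union, Finset.mem_insert, Finset.mem_singleton, List.mem_append,
      List.mem_cons] at hx this ⊢
    tauto

/-- Of two hanging edges that are joined to each other take the closest ones: by planarity nothing
hangs between them. -/
theorem exists_neighbours [Finite X] (hσ : FourValent σ e) (h : SweepState σ e L S Z f g)
    (hL : ∀ x ∈ L, e x ∈ S) (n : ℕ) :
    ∀ A a M B, Z = A ++ a :: (M ++ g a :: B) → g a ≠ a → M.length = n →
      ∃ A a M B, Z = A ++ a :: (M ++ g a :: B) ∧ g a ≠ a ∧ ∀ x ∈ M, g x = x := by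
  have hgg {x : X} (hx : g x ≠ x) : g (g x) = x := by
    have hgx : g x = e x := (h.g_or x).resolve_left hx
    rcases h.g_or (g x) with k | k
    · exact absurd (g.injective k) hx
    · rw [k, hgx, hσ.edge_edge]
  induction n using Nat.strong_induction_on with
  | _ n ih
  intro A a M B hZ hga hn
  by_cases hM : ∀ x ∈ M, g x = x
  · exact ⟨A, a, M, B, hZ, hga, hM⟩
  push Not at hM
  obtain ⟨x, hxM, hgx⟩ := hM
  have hxL : x ∈ L := by
    rw [h.L_eq, hZ]
    simp [hxM, hgx]
  have hyZ : g x ∈ Z := by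
    refine h.live_mem _ ?_ fun k => hgx (g.injective k)
    rw [(h.g_or x).resolve_left hgx]
    exact hL x hxL
  have hnd := h.nodup
  rw [hZ] at hnd
  have hch := h.chain
  rw [hZ, List.isChain_split] at hch
  have hxa : x ≠ a := by
    rintro rfl
    simp [List.nodup_append, hxM] at hnd
  have hxga : x ≠ g a := by
    rintro rfl
    have := (List.nodup_cons.1 (List.nodup_append.1 hnd).2.1).2
    exact (List.nodup_append.1 this).2.2 _ hxM (g a) (by simp) rfl
  -- The edge at `a` is a loop of the contracted map, so contracting it puts `a` and `g a` into
  -- different components.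
  have hs : f.SameCycle a (g a) := sameCycle_of_isChain hch.2 (by simp)
  obtain ⟨-, hnc⟩ := h.spherical.contract_of_sameCycle hga hs
  have hf' {x : X} (hx : x ≠ a) (hx' : x ≠ g a) : (f * swap a (g a)) x = f x := by
    simp [swap_apply_of_ne_of_ne hx hx']
  have ndall := hnd
  rw [List.nodup_append, List.nodup_cons, List.nodup_append, List.nodup_cons] at hnd
  obtain ⟨ndA, ⟨haMB, ndM, ⟨hgaB, ndB⟩, hdisj'⟩, hdisj⟩ := hnd
  simp only [List.mem_append, List.mem_cons, not_or] at haMB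
  have haA : a ∉ A := fun k => hdisj a k a (by simp) rfl
  have hgaA : g a ∉ A := fun k => hdisj (g a) k (g a) (by simp) rfl
  have hgaM : g a ∉ M := fun k => hdisj' (g a) k (g a) (by simp) rfl
  set f' := f * swap a (g a) with hf'def
  set g' := swap a (g a) * g with hg'def
  -- The split cycle goes from `g a` into `M`, hence `x` and its partner `g x` are on the side of `g
  -- a`.
  have hbx : connected f' g' (g a) x := by
    have hch' : (g a :: M).IsChain fun x y => f' x = y := by
      have hch2 := hch.2
      rw [← List.cons_append, List.isChain_split] at hch2
      cases M with
      | nil => exact List.IsChain.singleton _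
      | cons c M =>
        have h2 := List.isChain_append.1 hch2.1
        simp only [List.isChain_cons_cons] at h2 ⊢
        exact ⟨by simpa [hf'def] using h2.1.1, isChain_congr h2.1.2 fun x hx =>
          hf' (fun k => haMB.1 (k ▸ hx)) fun k => hgaM (k ▸ hx)⟩
    exact connected_of_isChain hch' (by simp [hxM])
  have hxy : connected f' g' x (g x) := by
    have := connected_right f' g' x
    rwa [hg'def, swap_mul_apply_of_ne hσ h.g_or hga hxa hxga] at this
  -- The darts of `A` lead to `a`, and `a` now leads to `B`. A partner in either list would connect
  -- the two sides.
  have hout : g x ∉ A ∧ g x ∉ B := by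
    refine ⟨fun k => ?_, fun k => ?_⟩
    · obtain ⟨A1, A2, rfl⟩ := List.append_of_mem k
      have h1 : ((g x :: A2) ++ [a]).IsChain fun x y => f x = y := by
        have := hch.1
        rw [List.append_assoc, List.cons_append, List.isChain_split] at this
        simpa using this.2
      have h2 := isChain_congr_append (f' := f') h1 fun z hz =>
        hf' (fun k => haA (k ▸ by simp_all)) fun k => hgaA (k ▸ by simp_all)
      have h3 : connected f' g' (g x) a := connected_of_isChain (Z := A2 ++ [a]) h2 (by simp)
      exact hnc ((connected f' g').symm (Setoid.trans' _ hbx (Setoid.trans' _ hxy h3)))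
    · have h1 : (a :: B).IsChain fun x y => f' x = y := by
        have hch2 := hch.2
        rw [← List.cons_append, List.isChain_split] at hch2
        cases B with
        | nil => exact List.IsChain.singleton _
        | cons c B =>
          have h2 := hch2.2
          simp only [List.isChain_cons_cons] at h2 ⊢
          exact ⟨by simpa [hf'def] using h2.1, isChain_congr h2.2 fun x hx =>
            hf' (fun k => haMB.2.2 (k ▸ hx)) fun k => hgaB (k ▸ hx)⟩
      have h3 : connected f' g' a (g x) := connected_of_isChain h1 (by simp [k])
      exact hnc (Setoid.trans' _ h3 ((connected f' g').symm (Setoid.trans' _ hbx hxy)))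
  have hyM : g x ∈ M := by
    rw [hZ] at hyZ
    simp only [List.mem_append, List.mem_cons] at hyZ
    rcases hyZ with k | k | k | k | k
    · exact absurd k hout.1
    · exact absurd (by rw [← k, hgg hgx]) hxga
    · exact k
    · exact absurd (g.injective k) hxa
    · exact absurd k hout.2
  obtain ⟨M1, M2, rfl⟩ := List.append_of_mem hxM
  simp only [List.mem_append, List.mem_cons, hgx, false_or] at hyM
  simp only [List.length_append, List.length_cons] at hn
  -- Both ends lie inside `M`, in one order or the other; the induction continues with this closer
  -- pair.
  rcases hyM with k | k
  · obtain ⟨M3, M4, rfl⟩ := List.append_of_mem k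
    simp only [List.length_append, List.length_cons] at hn
    refine ih M4.length (by omega) (A ++ a :: M3) (g x) M4 (M2 ++ g a :: B) ?_
      (fun k => hgx (g.injective k)) rfl
    rw [hZ, hgg hgx]
    simp
  · obtain ⟨M3, M4, rfl⟩ := List.append_of_mem k
    simp only [List.length_append, List.length_cons] at hn
    refine ih M3.length (by omega) (A ++ a :: M1) x M3 (M4 ++ g a :: B) ?_ hgx rfl
    rw [hZ]
    simp

/-- If no hanging edge leads to a new vertex, the partner of each live dart is in `Z` too.
Contracting a loop with only dead darts in between splits off a cycle that may be forgotten, and `A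
++ a :: B` remains as a chain of the other one. -/
theorem cap_step [Finite X] (hσ : FourValent σ e) (h : SweepState σ e L S Z f g)
    (hne : L ≠ []) (hL : ∀ x ∈ L, e x ∈ S) :
    ∃ L' Z' f' g', L'.length + 2 = L.length ∧ SweepState σ e L' S Z' f' g' := by
  have hgg {x : X} (hx : g x ≠ x) : g (g x) = x := by
    have hgx : g x = e x := (h.g_or x).resolve_left hx
    rcases h.g_or (g x) with k | k
    · exact absurd (g.injective k) hx
    · rw [k, hgx, hσ.edge_edge]
  obtain ⟨A, a, M, B, hZ, hga, hM⟩ : ∃ A a M B, Z = A ++ a :: (M ++ g a :: B) ∧ g a ≠ a ∧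
      ∀ x ∈ M, g x = x := by
    obtain ⟨a, ha⟩ := List.exists_mem_of_ne_nil L hne
    have hLZ : a ∈ Z ∧ g a ≠ a := by
      have := h.L_eq ▸ ha
      simpa using this
    obtain ⟨haZ, hga⟩ := hLZ
    have hbZ : g a ∈ Z := by
      refine h.live_mem _ ?_ fun k => hga (g.injective k)
      rw [(h.g_or a).resolve_left hga]
      exact hL a ha
    obtain ⟨A, B, hAB⟩ := List.append_of_mem haZ
    rw [hAB] at hbZ
    simp only [List.mem_append, List.mem_cons, hga, false_or] at hbZ
    rcases hbZ with k | k
    · obtain ⟨M3, M4, rfl⟩ := List.append_of_mem k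
      refine h.exists_neighbours hσ hL _ M3 (g a) M4 B ?_ (fun k => hga (g.injective k)) rfl
      rw [hAB, hgg hga]
      simp
    · obtain ⟨M3, M4, rfl⟩ := List.append_of_mem k
      exact h.exists_neighbours hσ hL _ A a M3 M4 hAB hga rfl
  subst hZ
  have hch := h.chain
  rw [List.isChain_split] at hch
  have hs : f.SameCycle a (g a) := sameCycle_of_isChain hch.2 (by simp)
  have hf' {x : X} (hx : x ≠ a) (hx' : x ≠ g a) : (f * swap a (g a)) x = f x := by
    simp [swap_apply_of_ne_of_ne hx hx']
  have hnd := h.nodup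
  rw [List.nodup_append, List.nodup_cons, List.nodup_append, List.nodup_cons] at hnd
  obtain ⟨ndA, ⟨haMB, ndM, ⟨hgaB, ndB⟩, hdisj'⟩, hdisj⟩ := hnd
  simp only [List.mem_append, List.mem_cons, not_or] at haMB
  have haA : a ∉ A := fun k => hdisj a k a (by simp) rfl
  have hgaA : g a ∉ A := fun k => hdisj (g a) k (g a) (by simp) rfl
  have haS : a ∈ S := h.subset a (by simp)
  have hgaS : g a ∈ S := h.subset (g a) (by simp)
  have hneS {x : X} (hx : x ∉ S) : x ≠ a ∧ x ≠ g a :=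
    ⟨fun k => hx (k ▸ haS), fun k => hx (k ▸ hgaS)⟩
  have hg' := swap_mul_fixed_iff hσ h.g_or hga
  have hLe : L = A.filter (fun x => g x ≠ x) ++ a :: g a :: B.filter fun x => g x ≠ x := by
    have : M.filter (fun x => g x ≠ x) = [] := by
      rw [List.filter_eq_nil_iff]
      intro x hx
      simpa using hM x hx
    rw [h.L_eq, List.filter_append, List.filter_cons_of_pos (by simpa using hga),
      List.filter_append, this, List.nil_append, List.filter_cons_of_pos (by simpa using hga)]
  refine ⟨A.filter (fun x => g x ≠ x) ++ B.filter (fun x => g x ≠ x), A ++ a :: B,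
    f * swap a (g a), swap a (g a) * g, ?_, (hLe ▸ h.reach).cap
      ((h.g_or a).resolve_left hga).symm, (h.spherical.contract_of_sameCycle hga hs).1, ?_, ?_,
      swap_mul_or hσ h.g_or hga, ?_, ?_, ?_, ?_, ?_⟩
  · rw [hLe]; simp only [List.length_append, List.length_cons]; omega
  · intro x hx
    rw [hf' (hneS hx).1 (hneS hx).2, h.f_eq x hx]
  · intro x hx
    rw [swap_mul_apply_of_ne hσ h.g_or hga (hneS hx).1 (hneS hx).2, h.g_eq x hx]
  · have dead : ¬ (swap a (g a) * g) a ≠ a := by simp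
    rw [List.filter_append, filter_ne_cons_neg dead, filter_congr_of_not_mem hg' haA hgaA,
      filter_congr_of_not_mem hg' haMB.2.2 hgaB]
  · rw [List.nodup_append, List.nodup_cons]
    refine ⟨ndA, ⟨haMB.2.2, ndB⟩, fun x hx y hy => hdisj x hx y ?_⟩
    simp only [List.mem_cons, List.mem_append] at hy ⊢
    tauto
  · rw [List.isChain_split]
    refine ⟨isChain_congr_append hch.1 fun x hx => hf' (fun k => haA (k ▸ hx))
      fun k => hgaA (k ▸ hx), ?_⟩
    have hch2 := hch.2
    rw [← List.cons_append, List.isChain_split] at hch2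
    cases B with
    | nil => exact List.IsChain.singleton _
    | cons c B =>
      have h2 := hch2.2
      simp only [List.isChain_cons_cons] at h2 ⊢
      exact ⟨by simpa using h2.1, isChain_congr h2.2 fun x hx =>
        hf' (fun k => haMB.2.2 (k ▸ hx)) fun k => hgaB (k ▸ hx)⟩
  · intro x hx hxg
    obtain ⟨hxg, hxa, hxb⟩ := (hg' x).1 hxg
    have := h.live_mem x hx hxg
    simp only [List.mem_append, List.mem_cons] at this ⊢
    rcases this with k | k | k | k | k
    · exact Or.inl k
    · exact absurd k hxa
    · exact absurd (hM x k) hxg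
    · exact absurd k hxb
    · exact Or.inr (Or.inr k)
  · intro x hx
    refine h.subset x ?_
    simp only [List.mem_append, List.mem_cons] at hx ⊢
    tauto

end SweepState

/-- A spherical four-valent map can be drawn by a sweep. -/
theorem reach_univ [Fintype X] (hσ : FourValent σ e) (hs : Spherical σ e) :
    Reach σ e [] Finset.univ := by
  -- The measure falls by 4 when a component starts (four darts drawn, four edges hanging), by 6
  -- when a vertex is attached (two more edges hanging) and by 2 at a cap.
  suffices H : ∀ n L S Z f g, SweepState σ e L S Z f g → 2 * Sᶜ.card + L.length = n →
      Reach σ e [] Finset.univ from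
    H _ [] ∅ [] σ e ⟨Reach.nil, hs, fun _ _ => rfl, fun _ _ => rfl, fun _ => Or.inr rfl, rfl,
      List.nodup_nil, List.IsChain.nil, by simp, by simp⟩ rfl
  intro n
  induction n using Nat.strong_induction_on with
  | _ n ih
  intro L S Z f g h hn
  have hcard {d : X} (hd : d ∉ S) :
      (S ∪ {d, σ d, σ (σ d), σ (σ (σ d))})ᶜ.card + 4 = Sᶜ.card := by
    have h6 := card_union_orbit hσ (fun x => h.reach.mem_of_rotation_mem hσ) hd
    have h7 := Finset.card_add_card_compl S
    have h8 := Finset.card_add_card_compl (S ∪ {d, σ d, σ (σ d), σ (σ (σ d))})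
    omega
  by_cases hL : L = []
  · subst hL
    by_cases hS : S = Finset.univ
    · exact hS ▸ h.reach
    obtain ⟨d, hd⟩ : ∃ d, d ∉ S := by
      by_contra! hc
      exact hS (Finset.eq_univ_iff_forall.2 hc)
    obtain ⟨Z', h'⟩ := h.start_step hσ hd
    refine ih _ ?_ _ _ _ _ _ h' rfl
    have := hcard hd
    simp only [List.length_cons, List.length_nil] at hn ⊢
    omega
  by_cases hLS : ∀ x ∈ L, e x ∈ S
  · obtain ⟨L', Z', f', g', hlen, h'⟩ := h.cap_step hσ hL hLS
    exact ih _ (by omega) _ _ _ _ _ h' rfl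
  · push Not at hLS
    obtain ⟨a, ha, hb⟩ := hLS
    obtain ⟨L', Z', f', g', hlen, h'⟩ := h.attach_step hσ ha rfl hb
    have := hcard hb
    exact ih _ (by omega) _ _ _ _ _ h' rfl

end Sweep

end Hypermap

/-! ## Removing the vertices of degree two -/

theorem card_quotient_eq {X Y : Type*} (s : Setoid X) (t : Setoid Y) (f : Y → X) (p : X → Y)
    (hf : ∀ x y, t x y → s (f x) (f y)) (hp : ∀ x y, s x y → t (p x) (p y))
    (hpf : ∀ y, p (f y) = y) (hfp : ∀ x, s x (f (p x))) :
    Nat.card (Quotient t) = Nat.card (Quotient s) :=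
  Nat.card_congr
    { toFun := Quotient.map f fun _ _ h => hf _ _ h
      invFun := Quotient.map p fun _ _ h => hp _ _ h
      left_inv := by
        intro q
        induction q using Quotient.inductionOn with | _ y
        exact congrArg (Quotient.mk t) (hpf y)
      right_inv := by
        intro q
        induction q using Quotient.inductionOn with | _ x
        exact Quotient.sound (s.symm (hfp x)) }

theorem card_quotient_add_one {X Y : Type*} [Finite X] (s : Setoid X) (t : Setoid Y) (f : Y → X)
    (z : X) (hf : ∀ x y, t x y ↔ s (f x) (f y)) (hz : ∀ y, ¬ s (f y) z)
    (hs : ∀ x, ¬ s x z → ∃ y, s x (f y)) :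
    Nat.card (Quotient t) + 1 = Nat.card (Quotient s) := by
  have e : Quotient t ≃ {q : Quotient s // q ≠ Quotient.mk s z} := by
    refine Equiv.ofBijective (fun q => ⟨Quotient.map f (fun x y h => (hf x y).1 h) q, ?_⟩) ⟨?_, ?_⟩
    · induction q using Quotient.inductionOn with | _ y
      exact fun h => hz y (Quotient.exact h)
    · intro q q' h
      induction q using Quotient.inductionOn with | _ x
      induction q' using Quotient.inductionOn with | _ y
      exact Quotient.sound ((hf x y).2 (Quotient.exact (congrArg Subtype.val h)))
    · rintro ⟨q, hq⟩
      induction q using Quotient.inductionOn with | _ x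
      obtain ⟨y, hy⟩ := hs x fun h => hq (Quotient.sound h)
      exact ⟨Quotient.mk t y, Subtype.ext (Quotient.sound (s.symm hy))⟩
  classical
  have := Fintype.ofFinite (Quotient s)
  have h0 : 0 < Fintype.card (Quotient s) := Fintype.card_pos_iff.2 ⟨Quotient.mk s z⟩
  rw [Nat.card_congr e, Nat.card_eq_fintype_card, Nat.card_eq_fintype_card,
    Fintype.card_subtype_compl, Fintype.card_subtype_eq]
  omega

namespace LinkDiagram

open Hypermap Equiv.Perm

/-- Leaving a vertex along the dart `x` and following the strand straight through vertices of degree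
two, one may arrive at a vertex against the dart `y`. -/
inductive Trace (D : LinkDiagram) (x : D.Dart) : D.Dart → Prop
  | edge : Trace D x (D.edge x)
  | step {y : D.Dart} : Trace D x y → ¬ D.IsCrossing y → Trace D x (D.edge (D.next y))

theorem Trace.trans {D : LinkDiagram} {x y z : D.Dart} (h : D.Trace x y) (hy : ¬ D.IsCrossing y)
    (h' : D.Trace (D.next y) z) : D.Trace x z := by
  induction h' with
  | edge => exact h.step hy
  | step _ hw ih => exact ih.step hw

theorem Trace.exists_iterate {D : LinkDiagram} {x y : D.Dart} (h : D.Trace x y) :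
    ∃ n, y = (fun z => D.edge (D.next z))^[n] (D.edge x) ∧
      ∀ m < n, ¬ D.IsCrossing ((fun z => D.edge (D.next z))^[m] (D.edge x)) := by
  induction h with
  | edge => exact ⟨0, rfl, by simp⟩
  | step _ hy ih =>
    obtain ⟨n, rfl, hn⟩ := ih
    refine ⟨n + 1, by rw [Function.iterate_succ_apply'], fun m hm => ?_⟩
    rcases Nat.lt_succ_iff_lt_or_eq.1 hm with h | rfl
    · exact hn m h
    · exact hy

/-- Both darts are found by iterating the same map from `edge x` up to the first crossing. -/
theorem Trace.eq_of_isCrossing {D : LinkDiagram} {x y z : D.Dart} (hy : D.Trace x y)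
    (hz : D.Trace x z) (cy : D.IsCrossing y) (cz : D.IsCrossing z) : y = z := by
  obtain ⟨n, rfl, hn⟩ := hy.exists_iterate
  obtain ⟨m, rfl, hm⟩ := hz.exists_iterate
  rcases lt_trichotomy n m with h | rfl | h
  · exact absurd cy (hm n h)
  · rfl
  · exact absurd cz (hn m h)

theorem sameComponent_edge (D : LinkDiagram) (x : D.Dart) : D.SameComponent x (D.edge x) :=
  Relation.EqvGen.rel _ _ (Or.inl rfl)

theorem sameComponent_opposite (D : LinkDiagram) (x : D.Dart) :
    D.SameComponent x (D.opposite x) :=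
  Relation.EqvGen.rel _ _ (Or.inr rfl)

theorem Trace.sameComponent {D : LinkDiagram} {x y : D.Dart} (h : D.Trace x y) :
    D.SameComponent x y := by
  induction h with
  | edge => exact D.sameComponent_edge x
  | step _ hy ih =>
    refine ih.trans _ _ _ (Relation.EqvGen.trans _ _ _ ?_ (D.sameComponent_edge _))
    have := D.sameComponent_opposite ‹_›
    rwa [opposite, if_neg hy] at this

theorem IsCrossing.next {D : LinkDiagram} {x : D.Dart} (h : D.IsCrossing x) :
    D.IsCrossing (D.next x) := fun h' => h (D.next.injective h')

theorem card_edge (D : LinkDiagram) : 2 * Nat.card D.Edge = Nat.card D.Dart := by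
  have := D.finite_dart
  have e : D.Edge × Bool ≃ D.Dart := by
    refine Equiv.ofBijective (fun q => if q.2 then D.edge (Quotient.out q.1) else Quotient.out q.1)
      ⟨?_, ?_⟩
    · rintro ⟨q, i⟩ ⟨q', i'⟩ h
      have hq (q : D.Edge) (i : Bool) :
          Quotient.mk (SameCycle.setoid D.edge)
            (if i then D.edge (Quotient.out q) else Quotient.out q) = q := by
        conv_rhs => rw [← Quotient.out_eq q]
        refine Quotient.sound ?_
        cases i
        · exact SameCycle.refl _ _
        · exact sameCycle_apply_left.2 (SameCycle.refl _ _)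
      have h1 : q = q' := by rw [← hq q i, ← hq q' i']; exact congrArg _ h
      subst h1
      cases i <;> cases i'
      · rfl
      · exact absurd h.symm (D.edge_ne _)
      · exact absurd h (D.edge_ne _)
      · rfl
    · intro x
      have h : D.edge.SameCycle (Quotient.out (Quotient.mk (SameCycle.setoid D.edge) x)) x :=
        Quotient.exact (Quotient.out_eq (Quotient.mk (SameCycle.setoid D.edge) x))
      obtain ⟨i, -, hi⟩ := h.exists_pow_eq'
      have main : ∀ (i : ℕ) (z : D.Dart), (D.edge ^ i) z = z ∨ (D.edge ^ i) z = D.edge z := by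
        intro i z
        induction i with
        | zero => simp
        | succ i ih =>
          rw [pow_succ', mul_apply]
          rcases ih with ih | ih <;> rw [ih]
          · exact Or.inr rfl
          · exact Or.inl (D.edge_edge z)
      rcases main i (Quotient.out (Quotient.mk (SameCycle.setoid D.edge) x)) with k | k
      · exact ⟨(Quotient.mk _ x, false), k.symm.trans hi⟩
      · exact ⟨(Quotient.mk _ x, true), k.symm.trans hi⟩
  rw [← Nat.card_congr e, Nat.card_prod, Nat.card_eq_fintype_card (α := Bool), Fintype.card_bool,
    mul_comm]

/-- `D'` arises from `D` by erasing vertices of degree two. -/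
structure Reduction (D D' : LinkDiagram) (f : D'.Dart → D.Dart) : Prop where
  injective : Function.Injective f
  mem_range : ∀ x, D.IsCrossing x → x ∈ Set.range f
  next : ∀ x, f (D'.next x) = D.next (f x)
  isOver : ∀ x, D'.IsCrossing x → D'.isOver x = D.isOver (f x)
  trace : ∀ x, D.Trace (f x) (f (D'.edge x))

theorem Reduction.isCrossing_iff {D D' : LinkDiagram} {f : D'.Dart → D.Dart} (h : Reduction D D' f)
    (x : D'.Dart) : D.IsCrossing (f x) ↔ D'.IsCrossing x := by
  rw [IsCrossing, IsCrossing, ← h.next, ← h.next, h.injective.ne_iff]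

theorem Reduction.map_trace {D D' : LinkDiagram} {f : D'.Dart → D.Dart} (h : Reduction D D' f)
    {x y : D'.Dart} (hxy : D'.Trace x y) : D.Trace (f x) (f y) := by
  induction hxy with
  | edge => exact h.trace x
  | step _ hy ih =>
    refine ih.trans (fun k => hy ((h.isCrossing_iff _).1 k)) ?_
    rw [← h.next]
    exact h.trace _

theorem Reduction.refl (D : LinkDiagram) : Reduction D D id :=
  ⟨Function.injective_id, fun x _ => ⟨x, rfl⟩, fun _ => rfl, fun _ _ => rfl, fun _ => Trace.edge⟩

theorem Reduction.comp {D D' D'' : LinkDiagram} {f : D'.Dart → D.Dart} {g : D''.Dart → D'.Dart}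
    (hf : Reduction D D' f) (hg : Reduction D' D'' g) : Reduction D D'' (f ∘ g) where
  injective := hf.injective.comp hg.injective
  mem_range x hx := by
    obtain ⟨y, rfl⟩ := hf.mem_range x hx
    obtain ⟨z, rfl⟩ := hg.mem_range y ((hf.isCrossing_iff y).1 hx)
    exact ⟨z, rfl⟩
  next x := by simp [hg.next, hf.next]
  isOver x hx := by
    rw [hg.isOver x hx, hf.isOver _ ((hg.isCrossing_iff x).2 hx), Function.comp_apply]
  trace x := hf.map_trace (hg.trace x)

/-! ### Erasing one vertex of degree two -/

section Erase

variable (D : LinkDiagram) (a b : D.Dart)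

open Classical in
/-- The reversal after the two edges at a vertex of degree two are joined. -/
noncomputable def joinEdges : D.Dart → D.Dart :=
  Function.update (Function.update D.edge (D.edge a) (D.edge b)) (D.edge b) (D.edge a)

variable {D a b}

theorem edge_eq_iff {x y : D.Dart} : D.edge x = y ↔ x = D.edge y := by
  constructor
  · rintro rfl; rw [D.edge_edge]
  · rintro rfl; rw [D.edge_edge]

theorem joinEdges_right : D.joinEdges a b (D.edge b) = D.edge a := by
  classical
  rw [joinEdges, Function.update_self]

theorem joinEdges_left (hab : a ≠ b) : D.joinEdges a b (D.edge a) = D.edge b := by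
  classical
  rw [joinEdges, Function.update_of_ne (fun h => hab (D.edge.injective h)), Function.update_self]

theorem joinEdges_of_ne {x : D.Dart} (ha : x ≠ D.edge a) (hb : x ≠ D.edge b) :
    D.joinEdges a b x = D.edge x := by
  classical
  rw [joinEdges, Function.update_of_ne hb, Function.update_of_ne ha]

theorem joinEdges_ne (hab : a ≠ b) (he : D.edge a ≠ b) {x : D.Dart} :
    D.joinEdges a b x ≠ a ∧ D.joinEdges a b x ≠ b := by
  have he' : D.edge b ≠ a := fun h => he (edge_eq_iff.1 h).symm
  by_cases h1 : x = D.edge a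
  · rw [h1, joinEdges_left hab]; exact ⟨he', D.edge_ne b⟩
  by_cases h2 : x = D.edge b
  · rw [h2, joinEdges_right]; exact ⟨D.edge_ne a, he⟩
  · rw [joinEdges_of_ne h1 h2, Ne, Ne, edge_eq_iff, edge_eq_iff]
    exact ⟨h1, h2⟩

theorem joinEdges_joinEdges (hab : a ≠ b) {x : D.Dart} (ha : x ≠ a) (hb : x ≠ b) :
    D.joinEdges a b (D.joinEdges a b x) = x := by
  by_cases h1 : x = D.edge a
  · rw [h1, joinEdges_left hab, joinEdges_right]
  by_cases h2 : x = D.edge b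
  · rw [h2, joinEdges_right, joinEdges_left hab]
  · rw [joinEdges_of_ne h1 h2, joinEdges_of_ne, D.edge_edge]
    · exact fun h => ha (D.edge.injective h)
    · exact fun h => hb (D.edge.injective h)

theorem joinEdges_ne_self (hab : a ≠ b) (x : D.Dart) : D.joinEdges a b x ≠ x := by
  by_cases h1 : x = D.edge a
  · rw [h1, joinEdges_left hab]; exact fun h => hab (D.edge.injective h).symm
  by_cases h2 : x = D.edge b
  · rw [h2, joinEdges_right]; exact fun h => hab (D.edge.injective h)
  · rw [joinEdges_of_ne h1 h2]; exact D.edge_ne x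

theorem next_ne_of_ne (hab : D.next a = b) (hba : D.next b = a) {x : D.Dart} :
    (D.next x ≠ a ∧ D.next x ≠ b) ↔ (x ≠ a ∧ x ≠ b) := by
  nth_rewrite 1 [← hba]
  rw [← hab, D.next.injective.ne_iff, D.next.injective.ne_iff, hab]
  exact and_comm

variable (hab : D.next a = b) (hba : D.next b = a) (he : D.edge a ≠ b)

theorem ne_of_next_eq (hab : D.next a = b) : a ≠ b := fun h => D.next_ne a (hab.trans h.symm)

/-- The diagram without the vertex of degree two with darts `a` and `b`. -/
noncomputable def erase : LinkDiagram where
  Dart := {x : D.Dart // x ≠ a ∧ x ≠ b}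
  finite_dart := by have := D.finite_dart; infer_instance
  edge := Function.Involutive.toPerm
    (fun x => ⟨D.joinEdges a b x.1, joinEdges_ne (ne_of_next_eq hab) he⟩)
    fun x => Subtype.ext (joinEdges_joinEdges (ne_of_next_eq hab) x.2.1 x.2.2)
  next := D.next.subtypePerm fun _ => next_ne_of_ne hab hba
  isOver x := D.isOver x.1
  edge_edge x := Subtype.ext (joinEdges_joinEdges (ne_of_next_eq hab) x.2.1 x.2.2)
  edge_ne x h := joinEdges_ne_self (ne_of_next_eq hab) x.1 (congrArg Subtype.val h)
  next_ne x h := D.next_ne x.1 (congrArg Subtype.val h)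
  next_four x := Subtype.ext (D.next_four x.1)
  over_next x h := D.over_next x.1 fun k => h (Subtype.ext k)

theorem eraseVertex_erase : D.EraseVertex (erase hab hba he) :=
  ⟨a, b, hab, hba, he, Subtype.val, Subtype.val_injective, by
    refine (Subtype.range_val_subtype (p := fun x => x ≠ a ∧ x ≠ b)).trans ?_
    ext x
    simp only [Set.mem_ofPred_eq, Set.mem_compl_iff, Set.mem_insert_iff, Set.mem_singleton_iff,
      not_or, ne_eq], fun _ => rfl, fun _ => rfl, fun _ _ => rfl⟩

theorem erase_isCrossing (x : (erase hab hba he).Dart) :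
    (erase hab hba he).IsCrossing x ↔ D.IsCrossing x.1 :=
  not_congr Subtype.ext_iff

theorem ne_of_isCrossing (hab : D.next a = b) (hba : D.next b = a) {x : D.Dart}
    (h : D.IsCrossing x) : x ≠ a ∧ x ≠ b := by
  constructor
  · rintro rfl; exact h (by rw [hab, hba])
  · rintro rfl; exact h (by rw [hba, hab])

theorem reduction_erase : Reduction D (erase hab hba he) Subtype.val where
  injective := Subtype.val_injective
  mem_range x hx := ⟨⟨x, ne_of_isCrossing hab hba hx⟩, rfl⟩
  next _ := rfl
  isOver _ _ := rfl
  trace x := by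
    change D.Trace x.1 (D.joinEdges a b x.1)
    have hne := ne_of_next_eq hab
    by_cases h1 : x.1 = D.edge a
    · have h := (Trace.edge (D := D) (x := D.edge a)).step fun h =>
        (ne_of_isCrossing hab hba h).1 (D.edge_edge a)
      rw [D.edge_edge, hab] at h
      rwa [h1, joinEdges_left hne]
    by_cases h2 : x.1 = D.edge b
    · have h := (Trace.edge (D := D) (x := D.edge b)).step fun h =>
        (ne_of_isCrossing hab hba h).2 (D.edge_edge b)
      rw [D.edge_edge, hba] at h
      rwa [h2, joinEdges_right]
    · rw [joinEdges_of_ne h1 h2]; exact Trace.edge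

/-- A dart that is kept. -/
def eraseMk (x : D.Dart) (ha : x ≠ a) (hb : x ≠ b) : (erase hab hba he).Dart := ⟨x, ha, hb⟩

open Classical in
/-- The darts at the erased vertex are moved along their strand. -/
noncomputable def eraseProj (x : D.Dart) : (erase hab hba he).Dart :=
  if ha : x = a then eraseMk hab hba he (D.edge b) (fun h => he (edge_eq_iff.1 h).symm) (D.edge_ne b)
  else if hb : x = b then eraseMk hab hba he (D.edge a) (D.edge_ne a) he
  else eraseMk hab hba he x ha hb

theorem eraseProj_of_ne {x : D.Dart} (ha : x ≠ a) (hb : x ≠ b) :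
    eraseProj hab hba he x = eraseMk hab hba he x ha hb := by
  rw [eraseProj, dif_neg ha, dif_neg hb]

theorem eraseProj_left : eraseProj hab hba he a =
    eraseMk hab hba he (D.edge b) (fun h => he (edge_eq_iff.1 h).symm) (D.edge_ne b) := by
  rw [eraseProj, dif_pos rfl]

theorem eraseProj_right :
    eraseProj hab hba he b = eraseMk hab hba he (D.edge a) (D.edge_ne a) he := by
  rw [eraseProj, dif_neg (ne_of_next_eq hab).symm, dif_pos rfl]

theorem eraseProj_val (x : (erase hab hba he).Dart) : eraseProj hab hba he x.1 = x :=
  eraseProj_of_ne hab hba he x.2.1 x.2.2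

theorem erase_edge_left :
    (erase hab hba he).edge (eraseProj hab hba he a) = eraseProj hab hba he b := by
  rw [eraseProj_left, eraseProj_right]
  exact Subtype.ext joinEdges_right

theorem erase_edge_right :
    (erase hab hba he).edge (eraseProj hab hba he b) = eraseProj hab hba he a := by
  rw [← erase_edge_left, (erase hab hba he).edge_edge]

theorem eraseProj_edge (x : D.Dart) :
    eraseProj hab hba he (D.edge x) = (erase hab hba he).edge (eraseProj hab hba he x) := by
  have he' : D.edge b ≠ a := fun h => he (edge_eq_iff.1 h).symm
  by_cases ha : x = a
  · rw [ha, erase_edge_left, eraseProj_right, eraseProj_of_ne hab hba he (D.edge_ne a) he]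
  by_cases hb : x = b
  · rw [hb, erase_edge_right, eraseProj_left, eraseProj_of_ne hab hba he he' (D.edge_ne b)]
  by_cases h1 : x = D.edge a
  · rw [h1, D.edge_edge, eraseProj_of_ne hab hba he (D.edge_ne a) he, ← erase_edge_right,
      eraseProj_right]
  by_cases h2 : x = D.edge b
  · rw [h2, D.edge_edge, eraseProj_of_ne hab hba he he' (D.edge_ne b), ← erase_edge_left,
      eraseProj_left]
  · rw [eraseProj_of_ne hab hba he ha hb, eraseProj_of_ne]
    · exact Subtype.ext (joinEdges_of_ne h1 h2).symm
    · rwa [Ne, edge_eq_iff]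
    · rwa [Ne, edge_eq_iff]

theorem eraseProj_next_of_ne {x : D.Dart} (ha : x ≠ a) (hb : x ≠ b) :
    eraseProj hab hba he (D.next x) = (erase hab hba he).next (eraseProj hab hba he x) := by
  have h := (next_ne_of_ne hab hba).2 ⟨ha, hb⟩
  rw [eraseProj_of_ne hab hba he ha hb, eraseProj_of_ne hab hba he h.1 h.2]
  rfl

/-- Passing through the erased vertex becomes running along the joined edge; components and pieces
are therefore preserved. -/
theorem eraseProj_next_of_eq {x : D.Dart} (hx : x = a ∨ x = b) :
    eraseProj hab hba he (D.next x) = (erase hab hba he).edge (eraseProj hab hba he x) := by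
  rcases hx with rfl | rfl
  · rw [hab, erase_edge_left]
  · rw [hba, erase_edge_right]

theorem isCrossing_eraseProj {x : D.Dart} (ha : x ≠ a) (hb : x ≠ b) :
    (erase hab hba he).IsCrossing (eraseProj hab hba he x) ↔ D.IsCrossing x := by
  rw [eraseProj_of_ne hab hba he ha hb]
  exact erase_isCrossing hab hba he _

theorem sameComponent_eraseProj {x y : D.Dart} (h : D.SameComponent x y) :
    (erase hab hba he).SameComponent (eraseProj hab hba he x) (eraseProj hab hba he y) := by
  induction h with
  | refl => exact Relation.EqvGen.refl _
  | symm _ _ _ ih => exact ih.symm _ _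
  | trans _ _ _ _ _ ih ih' => exact ih.trans _ _ _ ih'
  | rel x y h =>
    rcases h with rfl | rfl
    · rw [eraseProj_edge]; exact sameComponent_edge _ _
    have h := (erase hab hba he).sameComponent_opposite (eraseProj hab hba he x)
    unfold opposite at h ⊢
    by_cases hx : D.IsCrossing x
    · have h1 := ne_of_isCrossing hab hba hx
      have h2 := ne_of_isCrossing hab hba hx.next
      rw [if_pos ((isCrossing_eraseProj hab hba he h1.1 h1.2).2 hx),
        ← eraseProj_next_of_ne hab hba he h1.1 h1.2,
        ← eraseProj_next_of_ne hab hba he h2.1 h2.2] at h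
      rwa [if_pos hx]
    · rw [if_neg hx]
      by_cases hxab : x = a ∨ x = b
      · rw [eraseProj_next_of_eq hab hba he hxab]; exact sameComponent_edge _ _
      · rw [not_or] at hxab
        rwa [if_neg (fun k => hx ((isCrossing_eraseProj hab hba he hxab.1 hxab.2).1 k)),
          ← eraseProj_next_of_ne hab hba he hxab.1 hxab.2] at h

theorem isKnot_erase (h : D.IsKnot) : (erase hab hba he).IsKnot := by
  refine ⟨h.1.map (eraseProj hab hba he), fun x y => ?_⟩
  rw [← eraseProj_val hab hba he x, ← eraseProj_val hab hba he y]
  exact sameComponent_eraseProj hab hba he (h.2 _ _)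

theorem everyComponentCrosses_erase (h : D.EveryComponentCrosses) :
    (erase hab hba he).EveryComponentCrosses := by
  intro x
  obtain ⟨y, hy, cy⟩ := h x.1
  have h1 := ne_of_isCrossing hab hba cy
  refine ⟨eraseProj hab hba he y, ?_, (isCrossing_eraseProj hab hba he h1.1 h1.2).2 cy⟩
  have := sameComponent_eraseProj hab hba he hy
  rwa [eraseProj_val] at this

theorem card_erase : Nat.card (erase hab hba he).Dart + 2 = Nat.card D.Dart := by
  classical
  have := D.finite_dart
  have := Fintype.ofFinite D.Dart
  have h1 : Nat.card (erase hab hba he).Dart = (({a, b} : Finset D.Dart)ᶜ).card := by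
    change Nat.card {x : D.Dart // x ≠ a ∧ x ≠ b} = _
    rw [Nat.card_eq_fintype_card, Fintype.card_subtype]
    congr 1
    ext x
    simp
  have h2 := Finset.card_add_card_compl ({a, b} : Finset D.Dart)
  rw [Finset.card_pair (ne_of_next_eq hab)] at h2
  rw [h1, Nat.card_eq_fintype_card]
  omega

theorem card_vertex_erase :
    Nat.card (erase hab hba he).Vertex + 1 = Nat.card D.Vertex := by
  have := D.finite_dart
  have key {x y : D.Dart} (h : D.next.SameCycle x y) : (x ≠ a ∧ x ≠ b) ↔ (y ≠ a ∧ y ≠ b) :=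
    sameCycle_induction (R := fun x y => (x ≠ a ∧ x ≠ b) ↔ (y ≠ a ∧ y ≠ b))
      ⟨fun _ => Iff.rfl, Iff.symm, Iff.trans⟩ (fun x => (next_ne_of_ne hab hba).symm) h
  refine card_quotient_add_one (SameCycle.setoid D.next)
    (SameCycle.setoid (erase hab hba he).next) Subtype.val a (fun x y => ?_) (fun y h => ?_)
    fun x h => ?_
  · exact (sameCycle_subtypePerm (p := fun z => z ≠ a ∧ z ≠ b)
      (h := fun _ => next_ne_of_ne hab hba))
  · exact ((key h).1 y.2).1 rfl
  · refine ⟨⟨x, ?_, ?_⟩, SameCycle.refl _ _⟩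
    · rintro rfl; exact h (SameCycle.refl _ _)
    · rintro rfl
      refine h ?_
      rw [← hba]
      exact sameCycle_apply_right.2 (SameCycle.refl _ _)

theorem Trace.connected {D : LinkDiagram} {x y : D.Dart} (h : D.Trace x y) :
    connected D.edge D.next x y := by
  induction h with
  | edge => exact connected_left _ _ _
  | step _ _ ih =>
    exact Setoid.trans' _ ih (Setoid.trans' _ (connected_right _ _ _) (connected_left _ _ _))

theorem card_piece_erase : Nat.card (erase hab hba he).Piece = Nat.card D.Piece := by
  refine card_quotient_eq (connected D.edge D.next)
    (connected (erase hab hba he).edge (erase hab hba he).next) Subtype.val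
    (eraseProj hab hba he) (fun x y h => ?_) (fun x y h => ?_) (eraseProj_val hab hba he)
    fun x => ?_
  · exact connected_le (s := Setoid.comap Subtype.val (connected D.edge D.next))
      (fun x => ((reduction_erase hab hba he).trace x).connected)
      (fun x => connected_right D.edge D.next x.1) h
  · refine connected_le (s := Setoid.comap (eraseProj hab hba he)
      (connected (erase hab hba he).edge (erase hab hba he).next)) (fun x => ?_) (fun x => ?_) h
    · rw [Setoid.comap_rel, eraseProj_edge]; exact connected_left _ _ _
    · rw [Setoid.comap_rel]
      by_cases hx : x = a ∨ x = b
      · rw [eraseProj_next_of_eq hab hba he hx]; exact connected_left _ _ _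
      · rw [not_or] at hx
        rw [eraseProj_next_of_ne hab hba he hx.1 hx.2]; exact connected_right _ _ _
  · by_cases ha : x = a
    · rw [ha, eraseProj_left]
      have := connected_right D.edge D.next a
      rw [hab] at this
      exact Setoid.trans' _ this (connected_left _ _ _)
    by_cases hb : x = b
    · rw [hb, eraseProj_right]
      have := connected_right D.edge D.next b
      rw [hba] at this
      exact Setoid.trans' _ this (connected_left _ _ _)
    · rw [eraseProj_of_ne hab hba he ha hb]; exact Setoid.refl' _ _

/-- No face disappears: `a` lies in the face of `edge b` and `b` in that of `edge a`, and these two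
darts are kept. -/
theorem card_face_erase : Nat.card (erase hab hba he).Face = Nat.card D.Face := by
  have step (z : D.Dart) : (D.next * D.edge).SameCycle z (D.next (D.edge z)) :=
    sameCycle_apply_right.2 (SameCycle.refl (D.next * D.edge) z)
  have step' (z : (erase hab hba he).Dart) :
      ((erase hab hba he).next * (erase hab hba he).edge).SameCycle z
        ((erase hab hba he).next ((erase hab hba he).edge z)) :=
    sameCycle_apply_right.2 (SameCycle.refl ((erase hab hba he).next * (erase hab hba he).edge) z)
  have hub := step (D.edge a)
  have hva := step (D.edge b)
  rw [D.edge_edge, hab] at hub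
  rw [D.edge_edge, hba] at hva
  refine card_quotient_eq (SameCycle.setoid (D.next * D.edge))
    (SameCycle.setoid ((erase hab hba he).next * (erase hab hba he).edge)) Subtype.val
    (eraseProj hab hba he) (fun x y h => ?_) (fun x y h => ?_) (eraseProj_val hab hba he)
    fun x => ?_
  · refine sameCycle_induction
      (Setoid.comap Subtype.val (SameCycle.setoid (D.next * D.edge))).iseqv (fun x => ?_) h
    change (D.next * D.edge).SameCycle x.1 (D.next (D.joinEdges a b x.1))
    by_cases h1 : x.1 = D.edge a
    · rw [h1, joinEdges_left (ne_of_next_eq hab)]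
      exact hub.trans (step b)
    by_cases h2 : x.1 = D.edge b
    · rw [h2, joinEdges_right]
      exact hva.trans (step a)
    · rw [joinEdges_of_ne h1 h2]; exact step x.1
  · refine sameCycle_induction (Setoid.comap (eraseProj hab hba he) (SameCycle.setoid
      ((erase hab hba he).next * (erase hab hba he).edge))).iseqv (fun x => ?_) h
    change ((erase hab hba he).next * (erase hab hba he).edge).SameCycle (eraseProj hab hba he x)
      (eraseProj hab hba he (D.next (D.edge x)))
    by_cases hx : D.edge x = a ∨ D.edge x = b
    · rw [eraseProj_next_of_eq hab hba he hx, eraseProj_edge, (erase hab hba he).edge_edge]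
    · rw [not_or] at hx
      rw [eraseProj_next_of_ne hab hba he hx.1 hx.2, eraseProj_edge]
      exact step' _
  · by_cases ha : x = a
    · rw [ha, eraseProj_left]; exact hva.symm
    by_cases hb : x = b
    · rw [hb, eraseProj_right]; exact hub.symm
    · rw [eraseProj_of_ne hab hba he ha hb]; exact SameCycle.refl _ _

/-- One vertex and one edge (two darts) are lost, while faces and pieces keep their number. -/
theorem planar_erase (h : D.Planar) : (erase hab hba he).Planar := by
  have h1 := card_vertex_erase hab hba he
  have h2 := card_piece_erase hab hba he
  have h3 := card_face_erase hab hba he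
  have h4 := D.card_edge
  have h5 := (erase hab hba he).card_edge
  have h6 := card_erase hab hba he
  rw [Planar] at h ⊢
  omega

end Erase

/-- Up to equivalence all vertices of degree two can be erased, apart from one on each circle
without crossings. -/
theorem exists_reduction (D : LinkDiagram) : ∃ (D' : LinkDiagram) (f : D'.Dart → D.Dart),
    D.Equivalent D' ∧ Reduction D D' f ∧ (∀ x, ¬ D'.IsCrossing x → D'.edge x = D'.next x) ∧
      (D.Planar → D'.Planar) ∧ (D.IsKnot → D'.IsKnot) ∧
      (D.EveryComponentCrosses → D'.EveryComponentCrosses) := by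
  induction hn : Nat.card D.Dart using Nat.strong_induction_on generalizing D with
  | _ n ih
  by_cases h : ∀ x, ¬ D.IsCrossing x → D.edge x = D.next x
  · exact ⟨D, id, Relation.EqvGen.refl _, Reduction.refl D, h, id, id, id⟩
  push Not at h
  -- The inequality says that the vertex is not the only one on its circle, so there are two
  -- different edges to join.
  obtain ⟨a, ha, he⟩ := h
  have hba : D.next (D.next a) = a := not_not.1 ha
  have hcard := card_erase rfl hba he
  obtain ⟨D', f, h1, h2, h3, h4, h5, h6⟩ := ih _ (by omega) (erase rfl hba he) rfl
  exact ⟨D', _, (Relation.EqvGen.rel _ _ (Move.eraseVertex (eraseVertex_erase rfl hba he))).trans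
    _ _ _ h1, (reduction_erase rfl hba he).comp h2, h3, fun h => h4 (planar_erase rfl hba he h),
    fun h => h5 (isKnot_erase rfl hba he h), fun h => h6 (everyComponentCrosses_erase rfl hba he h)⟩

end LinkDiagram

/-! ## Tilings of the plane grid, built row by row -/

namespace Tiling

/-- The same connection point, seen from the other tile. -/
def mate (x : (ℤ × ℤ) × Side) : (ℤ × ℤ) × Side := (x.1 + x.2.step, x.2.flip)

theorem mate_mate (x : (ℤ × ℤ) × Side) : mate (mate x) = x := by
  obtain ⟨⟨i, j⟩, s⟩ := x
  cases s <;> simp [mate, Side.step, Side.flip]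

/-- The next connection point of the same tile. -/
def turn (T : ℤ × ℤ → Tile) (x : (ℤ × ℤ) × Side) : (ℤ × ℤ) × Side := (x.1, (T x.1).rot x.2)

/-- The side `s` is an end of an arc of the tile, and `s'` is the other end. -/
def Joins (t : Tile) (s s' : Side) : Prop := t.rot s = s' ∧ t.rot s' = s ∧ s' ≠ s

instance (t : Tile) (s s' : Side) : Decidable (Joins t s s') :=
  inferInstanceAs (Decidable (_ ∧ _ ∧ _))

theorem Joins.symm {t : Tile} {s s' : Side} (h : Joins t s s') : Joins t s' s :=
  ⟨h.2.1, h.1, h.2.2.symm⟩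

/-- Following the strand that leaves the tile of `x` at `x` without passing a crossing, one may
arrive at `y`. -/
inductive Trace (T : ℤ × ℤ → Tile) (x : (ℤ × ℤ) × Side) : (ℤ × ℤ) × Side → Prop
  | mate : Trace T x (mate x)
  | step {p : ℤ × ℤ} {s s' : Side} : Trace T x (p, s) → Joins (T p) s s' →
      Trace T x (Tiling.mate (p, s'))

theorem Trace.trans {T : ℤ × ℤ → Tile} {x z : (ℤ × ℤ) × Side} {p : ℤ × ℤ} {s s' : Side}
    (h : Trace T x (p, s)) (hs : Joins (T p) s s') (h' : Trace T (p, s') z) : Trace T x z := by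
  induction h' with
  | mate => exact h.step hs
  | step _ hw ih => exact ih.step hw

theorem Trace.symm {T : ℤ × ℤ → Tile} {x y : (ℤ × ℤ) × Side} (h : Trace T x y) : Trace T y x := by
  induction h with
  | mate => nth_rewrite 2 [← mate_mate x]; exact Trace.mate
  | step h hs ih =>
    rename_i p s s'
    have h1 : Trace T (Tiling.mate (p, s')) (p, s') := by
      nth_rewrite 2 [← mate_mate (p, s')]; exact Trace.mate
    exact h1.trans hs.symm ih

/-- Arcs lie on tiles that are not blank, so strands persist when only blank tiles are replaced. -/
theorem Trace.mono {T T' : ℤ × ℤ → Tile} (hT : ∀ p, T p ≠ Tile.blank → T' p = T p)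
    {x y : (ℤ × ℤ) × Side} (h : Trace T x y) : Trace T' x y := by
  induction h with
  | mate => exact Trace.mate
  | step _ hs ih =>
    refine ih.step ?_
    rwa [hT]
    intro hb
    rw [hb] at hs
    exact hs.2.2 (hs.1.symm)

theorem Trace.south {T : ℤ × ℤ → Tile} {x : (ℤ × ℤ) × Side} {i j : ℤ} {s : Side}
    (h : Trace T x ((i, j), s)) (hs : Joins (T (i, j)) s .south) :
    Trace T x ((i + 1, j), .north) := by
  simpa [Tiling.mate, Side.step, Side.flip] using h.step hs

theorem Trace.east {T : ℤ × ℤ → Tile} {x : (ℤ × ℤ) × Side} {i j : ℤ} {s : Side}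
    (h : Trace T x ((i, j), s)) (hs : Joins (T (i, j)) s .east) :
    Trace T x ((i, j + 1), .west) := by
  simpa [Tiling.mate, Side.step, Side.flip] using h.step hs

theorem Trace.west {T : ℤ × ℤ → Tile} {x : (ℤ × ℤ) × Side} {i j : ℤ} {s : Side}
    (h : Trace T x ((i, j), s)) (hs : Joins (T (i, j)) s .west) :
    Trace T x ((i, j - 1), .east) := by
  simpa [Tiling.mate, Side.step, Side.flip, sub_eq_add_neg] using h.step hs

theorem trace_west (T : ℤ × ℤ → Tile) (i j : ℤ) : Trace T ((i, j), .west) ((i, j - 1), .east) := by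
  simpa [mate, Side.step, Side.flip, sub_eq_add_neg] using
    Trace.mate (T := T) (x := ((i, j), .west))

theorem trace_east (T : ℤ × ℤ → Tile) (i j : ℤ) : Trace T ((i, j), .east) ((i, j + 1), .west) := by
  simpa [mate, Side.step, Side.flip] using Trace.mate (T := T) (x := ((i, j), .east))

theorem trace_south (T : ℤ × ℤ → Tile) (i j : ℤ) :
    Trace T ((i, j), .south) ((i + 1, j), .north) := by
  simpa [mate, Side.step, Side.flip] using Trace.mate (T := T) (x := ((i, j), .south))

theorem trace_north (T : ℤ × ℤ → Tile) (i j : ℤ) :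
    Trace T ((i, j), .north) ((i - 1, j), .south) := by
  simpa [mate, Side.step, Side.flip, sub_eq_add_neg] using
    Trace.mate (T := T) (x := ((i, j), .north))

/-- A row of tiles with connection points on the lower sides in the columns from `-h'` to `h' - 1`,
and on the upper sides in the columns from `-h` to `h - 1`. -/
structure IsRow (R : ℤ → Tile) (h h' N : ℕ) : Prop where
  narrow : ∀ j, R j ≠ Tile.blank → -(N : ℤ) ≤ j ∧ j < N
  horizontal : ∀ j, (R j).HasPoint .east ↔ (R (j + 1)).HasPoint .west
  south : ∀ j, (R j).HasPoint .south ↔ -(h' : ℤ) ≤ j ∧ j < h'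
  north : ∀ j, (R j).HasPoint .north ↔ -(h : ℤ) ≤ j ∧ j < h

/-- The tiling has `r` rows and is suitably connected except for `2 * h` strands that leave the last
row downwards. The strand `i` comes from the connection point `o i`, and all arcs lie on strands that
come from points in `Q`. -/
structure IsSheet (T : ℤ × ℤ → Tile) (r h N : ℕ) (o : ℕ → (ℤ × ℤ) × Side)
    (Q : Set ((ℤ × ℤ) × Side)) : Prop where
  rows : ∀ p, T p ≠ Tile.blank → 0 ≤ p.1 ∧ p.1 < r
  narrow : ∀ p, T p ≠ Tile.blank → -(N : ℤ) ≤ p.2 ∧ p.2 < N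
  horizontal : ∀ i j, (T (i, j)).HasPoint .east ↔ (T (i, j + 1)).HasPoint .west
  vertical : ∀ i j : ℤ, i ≠ r - 1 → ((T (i, j)).HasPoint .south ↔ (T (i + 1, j)).HasPoint .north)
  bottom : ∀ j, (T (r - 1, j)).HasPoint .south ↔ -(h : ℤ) ≤ j ∧ j < h
  strand : ∀ i < 2 * h, Trace T (o i) ((r, i - h), .north)
  cover : ∀ p s s', Joins (T p) s s' → ∃ y ∈ Q, Trace T y (p, s) ∨ Trace T y (p, s')

/-- It is used with the first row below a sheet, where all tiles are still blank. -/
def addRow (T : ℤ × ℤ → Tile) (r : ℕ) (R : ℤ → Tile) (p : ℤ × ℤ) : Tile :=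
  if p.1 = r then R p.2 else T p

theorem addRow_self (T : ℤ × ℤ → Tile) (r : ℕ) (R : ℤ → Tile) (j : ℤ) :
    addRow T r R (r, j) = R j := by simp [addRow]

theorem addRow_of_ne (T : ℤ × ℤ → Tile) (r : ℕ) (R : ℤ → Tile) {i : ℤ} (h : i ≠ r) (j : ℤ) :
    addRow T r R (i, j) = T (i, j) := by simp [addRow, h]

variable {T : ℤ × ℤ → Tile} {r h h' N : ℕ} {o o' : ℕ → (ℤ × ℤ) × Side}
  {Q Q' : Set ((ℤ × ℤ) × Side)} {R : ℤ → Tile}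

theorem IsSheet.addRow_eq (hT : IsSheet T r h N o Q) {p : ℤ × ℤ} (hp : T p ≠ Tile.blank) :
    addRow T r R p = T p :=
  addRow_of_ne T r R (hT.rows p hp).2.ne p.2

theorem IsSheet.addRow (hT : IsSheet T r h N o Q) (hR : IsRow R h h' N)
    (hQ : Q ⊆ Q')
    (hs : ∀ i < 2 * h', Trace (addRow T r R) (o' i) ((r + 1, i - h'), .north))
    (hc : ∀ j s s', Joins (R j) s s' →
      ∃ y ∈ Q', Trace (addRow T r R) y ((r, j), s) ∨ Trace (addRow T r R) y ((r, j), s')) :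
    IsSheet (addRow T r R) (r + 1) h' N o' Q' where
  rows p hp := by
    by_cases h : p.1 = r
    · constructor <;> push_cast <;> omega
    · have := hT.rows p (by rwa [Tiling.addRow, if_neg h] at hp)
      push_cast; omega
  narrow p hp := by
    by_cases h : p.1 = r
    · rw [Tiling.addRow, if_pos h] at hp
      exact hR.narrow _ hp
    · rw [Tiling.addRow, if_neg h] at hp
      exact hT.narrow p hp
  horizontal i j := by
    by_cases h : i = r
    · subst h; simp only [addRow_self]; exact hR.horizontal j
    · simp only [addRow_of_ne T r R h]; exact hT.horizontal i j
  vertical i j hi := by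
    push_cast at hi
    rw [addRow_of_ne T r R (by omega)]
    by_cases h : i = r - 1
    · subst h
      rw [show (r : ℤ) - 1 + 1 = r by omega, addRow_self, hT.bottom, hR.north]
    · rw [addRow_of_ne T r R (by omega)]
      exact hT.vertical i j h
  bottom j := by
    rw [show ((r + 1 : ℕ) : ℤ) - 1 = r by push_cast; omega, addRow_self]
    exact hR.south j
  strand i hi := by simpa using hs i hi
  cover p s s' hss := by
    obtain ⟨i, j⟩ := p
    by_cases h : i = r
    · subst h
      rw [addRow_self] at hss
      exact hc j s s' hss
    · rw [addRow_of_ne T r R h] at hss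
      obtain ⟨y, hy, hyt⟩ := hT.cover (i, j) s s' hss
      exact ⟨y, hQ hy, hyt.imp (Trace.mono fun p => hT.addRow_eq)
        (Trace.mono fun p => hT.addRow_eq)⟩

theorem IsSheet.strand_addRow (hT : IsSheet T r h N o Q) {i : ℕ} (hi : i < 2 * h) :
    Trace (Tiling.addRow T r R) (o i) ((r, i - h), .north) :=
  (hT.strand i hi).mono fun _ => hT.addRow_eq

/-- The row that places the crossing `t` in column `x` and moves the strands on its left by one
column to the left, and the strands on its right by one column to the right. -/
def crossRow (h : ℕ) (x : ℤ) (t : Tile) (j : ℤ) : Tile :=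
  if j < -h - 1 then .blank
  else if j = -h - 1 then .arcSE
  else if j < x then .arcsNWSE
  else if j = x then t
  else if j < h then .arcsENWS
  else if j = h then .arcWS
  else .blank

/-- The row that joins the strands in columns `x` and `x + 1` and moves the other strands by one
column to the middle. -/
def capRow (h : ℕ) (x : ℤ) (j : ℤ) : Tile :=
  if j < -h then .blank
  else if j = -h then .arcEN
  else if j ≤ x then .arcsENWS
  else if j < h - 1 then .arcsNWSE
  else if j = h - 1 then .arcNW
  else .blank

/-- The row that consists of the upper half of a circle. -/
def cupRow (j : ℤ) : Tile :=
  if j = -1 then .arcSE else if j = 0 then .arcWS else .blank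

theorem hasPoint_of_isCross {t : Tile} (ht : t = .crossHorizontalOver ∨ t = .crossVerticalOver)
    (s : Side) : t.HasPoint s := by
  unfold Tile.HasPoint
  rcases ht with rfl | rfl <;> revert s <;> decide

theorem not_joins_of_isCross {t : Tile} (ht : t = .crossHorizontalOver ∨ t = .crossVerticalOver)
    (s s' : Side) : ¬ Joins t s s' := by
  rcases ht with rfl | rfl <;> revert s s' <;> decide

instance (t : Tile) (s : Side) : Decidable (t.HasPoint s) :=
  inferInstanceAs (Decidable (t.rot s ≠ s))

theorem not_joins_blank (s s' : Side) : ¬ Joins .blank s s' := by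
  revert s s'; decide

theorem isRow_crossRow {x : ℤ} {t : Tile} (ht : t = .crossHorizontalOver ∨ t = .crossVerticalOver)
    (hx : -(h : ℤ) ≤ x) (hx' : x < h) (hN : h + 1 ≤ N) : IsRow (crossRow h x t) h (h + 1) N where
  narrow j hj := by
    unfold crossRow at hj
    split_ifs at hj <;> first | exact absurd rfl hj | omega
  horizontal j := by
    have := hasPoint_of_isCross ht
    unfold crossRow
    split_ifs <;> first
      | omega
      | decide
      | exact iff_of_true (this _) (by decide)
      | exact iff_of_true (by decide) (this _)
  north j := by
    have := hasPoint_of_isCross ht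
    unfold crossRow
    split_ifs <;> first
      | exact iff_of_true (this _) (by omega)
      | exact iff_of_true (by decide) (by omega)
      | exact iff_of_false (by decide) (by omega)
  south j := by
    have := hasPoint_of_isCross ht
    unfold crossRow
    push_cast
    split_ifs <;> first
      | exact iff_of_true (this _) (by omega)
      | exact iff_of_true (by decide) (by omega)
      | exact iff_of_false (by decide) (by omega)

theorem isRow_capRow {x : ℤ} (hx : -(h : ℤ) - 1 ≤ x) (hx' : x < h) (hN : h + 1 ≤ N) :
    IsRow (capRow (h + 1) x) (h + 1) h N where
  narrow j hj := by
    unfold capRow at hj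
    push_cast at hj
    split_ifs at hj <;> first | exact absurd rfl hj | omega
  horizontal j := by
    unfold capRow
    push_cast
    split_ifs <;> first
      | omega
      | decide
  north j := by
    unfold capRow
    push_cast
    split_ifs <;> first
      | exact iff_of_true (by decide) (by omega)
      | exact iff_of_false (by decide) (by omega)
  south j := by
    unfold capRow
    push_cast
    split_ifs <;> first
      | exact iff_of_true (by decide) (by omega)
      | exact iff_of_false (by decide) (by omega)

theorem isRow_cupRow (hN : 1 ≤ N) : IsRow cupRow 0 1 N where
  narrow j hj := by
    unfold cupRow at hj
    split_ifs at hj <;> first | exact absurd rfl hj | omega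
  horizontal j := by
    unfold cupRow
    split_ifs <;> first
      | omega
      | decide
  north j := by
    unfold cupRow
    split_ifs <;> exact iff_of_false (by decide) (by push_cast; omega)
  south j := by
    unfold cupRow
    push_cast
    split_ifs <;> first
      | exact iff_of_true (by decide) (by omega)
      | exact iff_of_false (by decide) (by omega)

/-! ### Adding a crossing below a strand -/

section CrossRow

variable {x : ℤ} {t : Tile}

theorem crossRow_self (hx : -(h : ℤ) ≤ x) : crossRow h x t x = t := by
  rw [crossRow, if_neg (by omega), if_neg (by omega), if_neg (by omega), if_pos rfl]

theorem crossRow_left {j : ℤ} (hj : -(h : ℤ) ≤ j) (hjx : j < x) :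
    crossRow h x t j = .arcsNWSE := by
  rw [crossRow, if_neg (by omega), if_neg (by omega), if_pos hjx]

theorem crossRow_right {j : ℤ} (hx : -(h : ℤ) ≤ x) (hj : j < h) (hjx : x < j) :
    crossRow h x t j = .arcsENWS := by
  rw [crossRow, if_neg (by omega), if_neg (by omega), if_neg (by omega), if_neg (by omega),
    if_pos hj]

theorem crossRow_left_end : crossRow h x t (-h - 1) = .arcSE := by
  rw [crossRow, if_neg (by omega), if_pos rfl]

theorem crossRow_right_end (hx' : x < h) : crossRow h x t h = .arcWS := by
  rw [crossRow, if_neg (by omega), if_neg (by omega), if_neg (by omega), if_neg (by omega),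
    if_neg (by omega), if_pos rfl]

theorem joins_crossRow_west {j : ℤ} (hj : -(h : ℤ) - 1 ≤ j) (hjx : j < x) :
    Joins (crossRow h x t j) .east .south := by
  rcases hj.eq_or_lt with rfl | hj
  · rw [crossRow_left_end]; decide
  · rw [crossRow_left (by omega) hjx]; decide

theorem joins_crossRow_east {j : ℤ} (hx : -(h : ℤ) ≤ x) (hj : j ≤ h) (hjx : x < j) :
    Joins (crossRow h x t j) .west .south := by
  rcases hj.eq_or_lt with rfl | hj
  · rw [crossRow_right_end (by omega)]; decide
  · rw [crossRow_right hx hj hjx]; decide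

/-- The origins of the strands after a crossing is attached to strand `k`. -/
def crossOrigin (o : ℕ → (ℤ × ℤ) × Side) (p : ℤ × ℤ) (k i : ℕ) : (ℤ × ℤ) × Side :=
  if i < k then o i
  else if i = k then (p, .west)
  else if i = k + 1 then (p, .south)
  else if i = k + 2 then (p, .east)
  else o (i - 2)

/-- Strand `k` ends at the upper side of the crossing, and three strands leave through the other
sides. As columns are counted from `-h - 1` afterwards, the strands that move left keep their index
and those that move right have it raised by two. -/
theorem IsSheet.cross (hT : IsSheet T r h N o Q) {k : ℕ} (hk : k < 2 * h)
    (ht : t = .crossHorizontalOver ∨ t = .crossVerticalOver) (hN : h + 1 ≤ N) (hQ : Q ⊆ Q')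
    (ho : ∀ i < 2 * h, i ≠ k → o i ∈ Q') (hp : ∀ s, (((r : ℤ), (k : ℤ) - h), s) ∈ Q') :
    IsSheet (Tiling.addRow T r (crossRow h (k - h) t)) (r + 1) (h + 1) N
      (crossOrigin o (r, k - h) k) Q' := by
  set x : ℤ := k - h with hx
  set T' := Tiling.addRow T r (crossRow h x t) with hT'
  have hxh : -(h : ℤ) ≤ x := by omega
  have hself (j : ℤ) : T' (r, j) = crossRow h x t j := addRow_self T r _ j
  have north (i : ℕ) (hi : i < 2 * h) : Trace T' (o i) ((r, i - h), .north) := hT.strand_addRow hi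
  have east (i : ℕ) (hi : i + 1 < k) : Trace T' (o (i + 1)) ((r, i - h), .east) := by
    have := (north (i + 1) (by omega)).west (by
      rw [hself, crossRow_left (by push_cast; omega) (by push_cast; omega)]; decide)
    convert this using 3
    push_cast; ring
  -- Strand 0 goes to column `-h - 1`, which is not of the form `i - h` with natural `i`.
  have east0 (hk : 0 < k) : Trace T' (o 0) ((r, -h - 1), .east) := by
    have := (north 0 (by omega)).west (by
      rw [hself, crossRow_left (by push_cast; omega) (by push_cast; omega)]; decide)
    convert this using 3
    push_cast; ring
  have west (i : ℕ) (hi : i < 2 * h) (hki : k < i) :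
      Trace T' (o i) ((r, i - h + 1), .west) :=
    (north i hi).east (by
      rw [hself, crossRow_right hxh (by omega) (by omega)]; decide)
  -- The eastern end next to the crossing is reached from the crossing itself, the others from old
  -- strands.
  have coverEast (j : ℤ) (hj : -(h : ℤ) - 1 ≤ j) (hjx : j < x) :
      ∃ y ∈ Q', Trace T' y ((r, j), .east) := by
    by_cases h1 : j = x - 1
    · subst h1
      exact ⟨_, hp .west, trace_west T' r x⟩
    · rcases hj.eq_or_lt with rfl | hj
      · exact ⟨_, ho 0 (by omega) (by omega), east0 (by omega)⟩
      · obtain ⟨i, rfl⟩ : ∃ i : ℕ, j = i - h := ⟨(j + h).toNat, by omega⟩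
        exact ⟨_, ho (i + 1) (by omega) (by omega), east i (by omega)⟩
  have coverWest (j : ℤ) (hj : j ≤ h) (hjx : x < j) :
      ∃ y ∈ Q', Trace T' y ((r, j), .west) := by
    by_cases h1 : j = x + 1
    · subst h1
      exact ⟨_, hp .east, trace_east T' r x⟩
    · obtain ⟨i, rfl⟩ : ∃ i : ℕ, j = i - h + 1 := ⟨(j + h - 1).toNat, by omega⟩
      exact ⟨_, ho i (by omega) (by omega), west i (by omega) (by omega)⟩
  have coverNorth (j : ℤ) (hj : -(h : ℤ) ≤ j) (hjh : j < h) (hjx : j ≠ x) :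
      ∃ y ∈ Q', Trace T' y ((r, j), .north) := by
    obtain ⟨i, rfl⟩ : ∃ i : ℕ, j = i - h := ⟨(j + h).toNat, by omega⟩
    exact ⟨_, ho i (by omega) (by omega), north i (by omega)⟩
  refine hT.addRow (isRow_crossRow ht hxh (by omega) hN) hQ (fun i hi => ?_) fun j s s' hss => ?_
  · unfold crossOrigin
    push_cast
    split_ifs with h1 h2 h3 h4
    · have := ((north i (by omega)).west (by
        rw [hself, crossRow_left (by omega) (by omega)]; decide)).south (by
        rw [hself]; exact joins_crossRow_west (by omega) (by omega))
      convert this using 3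
      ring
    · have := (trace_west T' r x).south (by
        rw [hself]; exact joins_crossRow_west (by omega) (by omega))
      convert this using 3
      omega
    · convert trace_south T' r x using 3
      omega
    · have := (trace_east T' r x).south (by
        rw [hself]; exact joins_crossRow_east hxh (by omega) (by omega))
      convert this using 3
      omega
    · have := (west (i - 2) (by omega) (by omega)).south (by
        rw [hself]; exact joins_crossRow_east hxh (by omega) (by omega))
      convert this using 3
      omega
  · change ∃ y ∈ Q', Trace T' y ((r, j), s) ∨ Trace T' y ((r, j), s')
    have use {s₀ : Side} (hs₀ : s = s₀ ∨ s' = s₀) (hy : ∃ y ∈ Q', Trace T' y ((r, j), s₀)) :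
        ∃ y ∈ Q', Trace T' y ((r, j), s) ∨ Trace T' y ((r, j), s') := by
      obtain ⟨y, hy, hyt⟩ := hy
      rcases hs₀ with rfl | rfl
      · exact ⟨y, hy, Or.inl hyt⟩
      · exact ⟨y, hy, Or.inr hyt⟩
    unfold crossRow at hss
    split_ifs at hss with h1 h2 h3 h4 h5 h6
    · exact absurd hss (not_joins_blank s s')
    · exact use (by revert hss; clear use; revert s s'; decide) (coverEast j (by omega) (by omega))
    · have : (s = .north ∨ s' = .north) ∨ (s = .east ∨ s' = .east) := by
        revert hss; clear use; revert s s'; decide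
      rcases this with h | h
      · exact use h (coverNorth j (by omega) (by omega) (by omega))
      · exact use h (coverEast j (by omega) (by omega))
    · exact absurd hss (not_joins_of_isCross ht s s')
    · have : (s = .north ∨ s' = .north) ∨ (s = .west ∨ s' = .west) := by
        revert hss; clear use; revert s s'; decide
      rcases this with h | h
      · exact use h (coverNorth j (by omega) (by omega) (by omega))
      · exact use h (coverWest j (by omega) (by omega))
    · exact use (by revert hss; clear use; revert s s'; decide) (coverWest j (by omega) (by omega))
    · exact absurd hss (not_joins_blank s s')

end CrossRow

/-! ### Joining two neighbouring strands -/

section CapRow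

variable {x : ℤ}

theorem joins_capRow_north_left {j : ℤ} (hj : -(h : ℤ) ≤ j) (hjx : j ≤ x) :
    Joins (capRow h x j) .north .east := by
  unfold capRow
  split_ifs <;> first | decide | omega

theorem joins_capRow_west {j : ℤ} (hj : -(h : ℤ) < j) (hjx : j ≤ x) :
    Joins (capRow h x j) .west .south := by
  unfold capRow
  split_ifs <;> first | decide | omega

theorem joins_capRow_north_right {j : ℤ} (hx : -(h : ℤ) ≤ x) (hj : j < h) (hjx : x < j) :
    Joins (capRow h x j) .north .west := by
  unfold capRow
  split_ifs <;> first | decide | omega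

theorem joins_capRow_east {j : ℤ} (hx : -(h : ℤ) ≤ x) (hj : j < h - 1) (hjx : x < j) :
    Joins (capRow h x j) .east .south := by
  unfold capRow
  split_ifs <;> first | decide | omega

/-- The origins of the strands after the strands `k` and `k + 1` are joined. -/
def capOrigin (o : ℕ → (ℤ × ℤ) × Side) (k i : ℕ) : (ℤ × ℤ) × Side :=
  if i < k then o i else o (i + 2)

/-- Columns are counted from `-h` instead of `-h - 1` afterwards, so the strands that move right
keep their index and those that move left have it lowered by two. -/
theorem IsSheet.cap (hT : IsSheet T r (h + 1) N o Q) {k : ℕ} (hk : k < 2 * h + 1)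
    (hN : h + 1 ≤ N) (ho : ∀ i < 2 * (h + 1), o i ∈ Q) :
    IsSheet (Tiling.addRow T r (capRow (h + 1) (k - (h + 1)))) (r + 1) h N (capOrigin o k) Q ∧
      Trace (Tiling.addRow T r (capRow (h + 1) (k - (h + 1)))) (o k) (o (k + 1)) := by
  set x : ℤ := k - (h + 1) with hx
  set T' := Tiling.addRow T r (capRow (h + 1) x) with hT'
  have hxh : -((h + 1 : ℕ) : ℤ) ≤ x := by push_cast; omega
  have hself (j : ℤ) : T' (r, j) = capRow (h + 1) x j := addRow_self T r _ j
  have north (i : ℕ) (hi : i < 2 * (h + 1)) :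
      Trace T' (o i) ((r, i - (h + 1)), .north) := by
    have := hT.strand_addRow (R := capRow (h + 1) x) hi
    push_cast at this
    exact this
  have west (i : ℕ) (hik : i ≤ k) : Trace T' (o i) ((r, i - h), .west) := by
    have := (north i (by omega)).east (by
      rw [hself]; exact joins_capRow_north_left (by push_cast; omega) (by omega))
    convert this using 3
    ring
  have east (i : ℕ) (hi : i < 2 * (h + 1)) (hik : k < i) :
      Trace T' (o i) ((r, i - h - 2), .east) := by
    have := (north i (by omega)).west (by
      rw [hself]; exact joins_capRow_north_right hxh (by push_cast; omega) (by omega))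
    convert this using 3
    ring
  have coverNorth (j : ℤ) (hj : -(h : ℤ) - 1 ≤ j) (hjh : j ≤ h) :
      ∃ y ∈ Q, Trace T' y ((r, j), .north) := by
    obtain ⟨i, rfl⟩ : ∃ i : ℕ, j = i - (h + 1) := ⟨(j + h + 1).toNat, by omega⟩
    exact ⟨_, ho i (by omega), north i (by omega)⟩
  have coverWest (j : ℤ) (hj : -(h : ℤ) ≤ j) (hjx : j ≤ x) :
      ∃ y ∈ Q, Trace T' y ((r, j), .west) := by
    obtain ⟨i, rfl⟩ : ∃ i : ℕ, j = i - h := ⟨(j + h).toNat, by omega⟩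
    exact ⟨_, ho i (by omega), west i (by omega)⟩
  have coverEast (j : ℤ) (hj : j < h) (hjx : x < j) :
      ∃ y ∈ Q, Trace T' y ((r, j), .east) := by
    obtain ⟨i, rfl⟩ : ∃ i : ℕ, j = i - h - 2 := ⟨(j + h + 2).toNat, by omega⟩
    exact ⟨_, ho i (by omega), east i (by omega) (by omega)⟩
  refine ⟨hT.addRow (isRow_capRow (by omega) (by omega) hN) subset_rfl (fun i hi => ?_)
    fun j s s' hss => ?_, ?_⟩
  · unfold capOrigin
    split_ifs with h1
    · exact (west i (by omega)).south (by
        rw [hself]; exact joins_capRow_west (by push_cast; omega) (by omega))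
    · have := (east (i + 2) (by omega) (by omega)).south (by
        rw [hself]; exact joins_capRow_east hxh (by push_cast; omega) (by push_cast; omega))
      convert this using 3
      push_cast; ring
  · change ∃ y ∈ Q, Trace T' y ((r, j), s) ∨ Trace T' y ((r, j), s')
    have use {s₀ : Side} (hs₀ : s = s₀ ∨ s' = s₀) (hy : ∃ y ∈ Q, Trace T' y ((r, j), s₀)) :
        ∃ y ∈ Q, Trace T' y ((r, j), s) ∨ Trace T' y ((r, j), s') := by
      obtain ⟨y, hy, hyt⟩ := hy
      rcases hs₀ with rfl | rfl
      · exact ⟨y, hy, Or.inl hyt⟩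
      · exact ⟨y, hy, Or.inr hyt⟩
    unfold capRow at hss
    push_cast at hss
    split_ifs at hss with h1 h2 h3 h4 h5
    · exact absurd hss (not_joins_blank s s')
    · exact use (by revert hss; clear use; revert s s'; decide) (coverNorth j (by omega) (by omega))
    · have : (s = .north ∨ s' = .north) ∨ (s = .west ∨ s' = .west) := by
        revert hss; clear use; revert s s'; decide
      rcases this with h | h
      · exact use h (coverNorth j (by omega) (by omega))
      · exact use h (coverWest j (by omega) (by omega))
    · have : (s = .north ∨ s' = .north) ∨ (s = .east ∨ s' = .east) := by
        revert hss; clear use; revert s s'; decide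
      rcases this with h | h
      · exact use h (coverNorth j (by omega) (by omega))
      · exact use h (coverEast j (by omega) (by omega))
    · exact use (by revert hss; clear use; revert s s'; decide) (coverNorth j (by omega) (by omega))
    · exact absurd hss (not_joins_blank s s')
  · have h1 := west k le_rfl
    have h2 : Trace T' (((r : ℤ), (k : ℤ) - h), .north) (o (k + 1)) := by
      have := (north (k + 1) (by omega)).symm
      convert this using 3
      push_cast; ring
    refine h1.trans ?_ h2
    rw [hself]
    exact (joins_capRow_north_right hxh (by push_cast; omega) (by omega)).symm

end CapRow

/-- The origins of the two ends of a half circle, if a crossing follows below its right end. -/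
def cupOrigin (r i : ℕ) : (ℤ × ℤ) × Side :=
  if i = 0 then ((r + 1, 0), .north) else ((r + 1, -1), .north)

/-- Each end of the half circle is the origin of the strand at the other end. Both of its arcs lie
on the strand from the right end, so only that point has to be in `Q'`. -/
theorem IsSheet.cup (hT : IsSheet T r 0 N o Q) (hN : 1 ≤ N) (hQ : Q ⊆ Q')
    (hp : (((r : ℤ) + 1, (0 : ℤ)), Side.north) ∈ Q') :
    IsSheet (Tiling.addRow T r cupRow) (r + 1) 1 N (cupOrigin r) Q' := by
  set T' := Tiling.addRow T r cupRow with hT'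
  have hself (j : ℤ) : T' (r, j) = cupRow j := addRow_self T r _ j
  have h1 : Trace T' ((r + 1, 0), .north) ((r, 0), .south) := by
    simpa using trace_north T' (r + 1) 0
  have h2 : Trace T' ((r + 1, 0), .north) ((r, -1), .east) := by
    simpa using h1.west (by rw [hself]; decide)
  have h3 : Trace T' ((r + 1, 0), .north) ((r + 1, -1), .north) :=
    h2.south (by rw [hself]; decide)
  refine hT.addRow (isRow_cupRow hN) hQ (fun i hi => ?_) fun j s s' hss => ?_
  · obtain rfl | rfl : i = 0 ∨ i = 1 := by omega
    · simpa [cupOrigin] using h3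
    · simpa [cupOrigin] using h3.symm
  · unfold cupRow at hss
    split_ifs at hss with k1 k2
    · subst k1
      have : s = .east ∨ s' = .east := by revert hss; revert s s'; decide
      rcases this with rfl | rfl
      · exact ⟨_, hp, Or.inl h2⟩
      · exact ⟨_, hp, Or.inr h2⟩
    · subst k2
      have : s = .south ∨ s' = .south := by revert hss; revert s s'; decide
      rcases this with rfl | rfl
      · exact ⟨_, hp, Or.inl h1⟩
      · exact ⟨_, hp, Or.inr h1⟩
    · exact absurd hss (not_joins_blank s s')

theorem isSheet_blank (N : ℕ) (o : ℕ → (ℤ × ℤ) × Side) (Q : Set ((ℤ × ℤ) × Side)) :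
    IsSheet (fun _ => .blank) 0 0 N o Q where
  rows p hp := absurd rfl hp
  narrow p hp := absurd rfl hp
  horizontal i j := iff_of_false (by decide) (by decide)
  vertical i j _ := iff_of_false (by decide) (by decide)
  bottom j := iff_of_false (by decide) (by push_cast; omega)
  strand i hi := absurd hi (by omega)
  cover p s s' h := absurd h (not_joins_blank s s')

end Tiling

/-! ### Drawing a sweep with tiles -/

namespace Tiling

open Hypermap Equiv

def IsCross (t : Tile) : Prop := t = .crossHorizontalOver ∨ t = .crossVerticalOver

variable {X : Type*} {T : ℤ × ℤ → Tile} {r h N : ℕ}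
  {o : ℕ → (ℤ × ℤ) × Side} {σ e : Perm X} {ov : X → Bool} {L : List X} {S : Finset X}
  {g : X → (ℤ × ℤ) × Side} {R : ℤ → Tile}

/-- The darts in `S` correspond, by `g`, to the ends of the crossings of the tiling. -/
structure IsMarking (σ : Perm X) (ov : X → Bool) (T : ℤ × ℤ → Tile) (S : Finset X)
    (g : X → (ℤ × ℤ) × Side) : Prop where
  injOn : Set.InjOn g S
  isCross : ∀ d ∈ S, IsCross (T (g d).1)
  next : ∀ d ∈ S, g (σ d) = turn T (g d)
  isOver : ∀ d ∈ S, (T (g d).1).isOver (g d).2 = ov d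
  surj : ∀ p s, IsCross (T p) → ∃ d ∈ S, g d = (p, s)

theorem IsCross.ne_blank {t : Tile} (h : IsCross t) : t ≠ .blank := by
  rcases h with rfl | rfl <;> decide

theorem IsMarking.addRow_apply (hg : IsMarking σ ov T S g)
    (hT : ∀ p, T p ≠ Tile.blank → 0 ≤ p.1 ∧ p.1 < r) {d : X} (hd : d ∈ S) :
    addRow T r R (g d).1 = T (g d).1 :=
  addRow_of_ne T r R (hT _ (hg.isCross d hd).ne_blank).2.ne _

theorem IsMarking.addRow (hg : IsMarking σ ov T S g)
    (hT : ∀ p, T p ≠ Tile.blank → 0 ≤ p.1 ∧ p.1 < r) (hR : ∀ j, ¬ IsCross (R j)) :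
    IsMarking σ ov (addRow T r R) S g where
  injOn := hg.injOn
  isCross d hd := by rw [hg.addRow_apply hT hd]; exact hg.isCross d hd
  next d hd := by rw [turn, hg.addRow_apply hT hd]; exact hg.next d hd
  isOver d hd := by rw [hg.addRow_apply hT hd]; exact hg.isOver d hd
  surj p s hp := by
    by_cases h : p.1 = r
    · rw [Tiling.addRow, if_pos h] at hp; exact absurd hp (hR _)
    · rw [Tiling.addRow, if_neg h] at hp; exact hg.surj p s hp

/-- The crossing tile whose vertical strand passes over exactly if `v` is true. -/
def crossTile (v : Bool) : Tile := if v then .crossVerticalOver else .crossHorizontalOver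

theorem isCross_crossTile (v : Bool) : IsCross (crossTile v) := by
  cases v
  · exact Or.inl rfl
  · exact Or.inr rfl

/-- The four darts of the crossing of `b` are placed on the tile `p`, beginning with its upper
side. -/
def mark [DecidableEq X] (σ : Perm X) (g : X → (ℤ × ℤ) × Side) (b : X) (p : ℤ × ℤ) (y : X) :
    (ℤ × ℤ) × Side :=
  if y = b then (p, .north)
  else if y = σ b then (p, .west)
  else if y = σ (σ b) then (p, .south)
  else if y = σ (σ (σ b)) then (p, .east)
  else g y

section Mark

variable [DecidableEq X] {b : X} {p : ℤ × ℤ}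

theorem mark_zero : mark σ g b p b = (p, .north) := by simp [mark]

theorem mark_one (hσ : FourValent σ e) : mark σ g b p (σ b) = (p, .west) := by
  simp [mark, hσ.ne_one]

theorem mark_two (hσ : FourValent σ e) : mark σ g b p (σ (σ b)) = (p, .south) := by
  simp [mark, hσ.ne_one, hσ.ne_two]

theorem mark_three (hσ : FourValent σ e) : mark σ g b p (σ (σ (σ b))) = (p, .east) := by
  simp [mark, hσ.ne_one, hσ.ne_two, hσ.ne_three]

theorem mark_of_not_mem {y : X} (hy : y ∉ ({b, σ b, σ (σ b), σ (σ (σ b))} : Finset X)) :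
    mark σ g b p y = g y := by
  simp only [Finset.mem_insert, Finset.mem_singleton, not_or] at hy
  simp [mark, hy]

theorem mark_of_mem (hS : ∀ x, σ x ∈ S → x ∈ S) (hb : b ∉ S) {y : X}
    (hy : y ∈ S) : mark σ g b p y = g y :=
  mark_of_not_mem (disjoint_orbit hS hb hy)

theorem exists_mark (hσ : FourValent σ e) (s : Side) :
    ∃ d ∈ S ∪ {b, σ b, σ (σ b), σ (σ (σ b))}, mark σ g b p d = (p, s) := by
  cases s
  · exact ⟨_, by simp, mark_three hσ⟩
  · exact ⟨_, by simp, mark_zero⟩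
  · exact ⟨_, by simp, mark_one hσ⟩
  · exact ⟨_, by simp, mark_two hσ⟩

/-- The rotation of a crossing tile runs north, west, south, east, as `mark` places the orbit of
`b`. Since `b` is on the upper side, the vertical strand must pass over exactly if `b` does. The old
darts sit in earlier rows, so injectivity persists. -/
theorem IsMarking.addRow_mark (hσ : FourValent σ e) (hover : ∀ x, ov (σ x) = !ov x)
    (hg : IsMarking σ ov T S g)
    (hT : ∀ p, T p ≠ Tile.blank → 0 ≤ p.1 ∧ p.1 < r) (hS : ∀ x, σ x ∈ S → x ∈ S)
    (hS' : ∀ x ∈ S, σ x ∈ S) (hb : b ∉ S)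
    {x : ℤ} (hx : R x = crossTile (ov b)) (hR : ∀ j, IsCross (R j) → j = x) :
    IsMarking σ ov (Tiling.addRow T r R) (S ∪ {b, σ b, σ (σ b), σ (σ (σ b))})
      (mark σ g b (r, x)) := by
  have hp : Tiling.addRow T r R (r, x) = crossTile (ov b) := by rw [addRow_self, hx]
  have old {d : X} (hd : d ∈ S) : mark σ g b (r, x) d = g d := mark_of_mem hS hb hd
  have hne {d : X} (hd : d ∈ S) (s : Side) : g d ≠ (((r : ℤ), x), s) := by
    intro hgd
    have := (hT _ (hg.isCross d hd).ne_blank).2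
    rw [hgd] at this
    exact lt_irrefl _ this
  have m0 : mark σ g b (r, x) b = (((r : ℤ), x), .north) := mark_zero
  have m1 : mark σ g b (r, x) (σ b) = (((r : ℤ), x), .west) := mark_one hσ
  have m2 : mark σ g b (r, x) (σ (σ b)) = (((r : ℤ), x), .south) := mark_two hσ
  have m3 : mark σ g b (r, x) (σ (σ (σ b))) = (((r : ℤ), x), .east) := mark_three hσ
  refine ⟨?_, ?_, ?_, ?_, ?_⟩
  · intro d hd d' hd' hdd
    simp only [Finset.coe_union, Set.mem_union, SetLike.mem_coe, Finset.mem_insert,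
      Finset.mem_singleton] at hd hd'
    rcases hd with hd | rfl | rfl | rfl | rfl <;>
      rcases hd' with hd' | hd' | hd' | hd' | hd' <;>
      first
        | (rw [old hd, old hd'] at hdd; exact hg.injOn hd hd' hdd)
        | (subst hd'; rw [old hd] at hdd; simp only [m0, m1, m2, m3] at hdd
           exact absurd hdd (hne hd _))
        | (rw [old hd'] at hdd; simp only [m0, m1, m2, m3] at hdd
           exact absurd hdd.symm (hne hd' _))
        | exact hd'.symm
        | (subst hd'; simp [m0, m1, m2, m3] at hdd)
  · intro d hd
    simp only [Finset.mem_union, Finset.mem_insert, Finset.mem_singleton] at hd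
    rcases hd with hd | rfl | rfl | rfl | rfl
    · rw [old hd, hg.addRow_apply hT hd]; exact hg.isCross d hd
    all_goals simp only [m0, m1, m2, m3, hp, isCross_crossTile]
  · intro d hd
    simp only [Finset.mem_union, Finset.mem_insert, Finset.mem_singleton] at hd
    have hrot : (crossTile (ov b)).rot = Side.ccw := by cases ov b <;> rfl
    rcases hd with hd | rfl | rfl | rfl | rfl
    · rw [old hd, old (hS' d hd), turn, hg.addRow_apply hT hd]; exact hg.next d hd
    · rw [m0, m1, turn, hp, hrot]; rfl
    · rw [m1, m2, turn, hp, hrot]; rfl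
    · rw [m2, m3, turn, hp, hrot]; rfl
    · rw [m3, hσ.four, m0, turn, hp, hrot]; rfl
  · intro d hd
    simp only [Finset.mem_union, Finset.mem_insert, Finset.mem_singleton] at hd
    rcases hd with hd | rfl | rfl | rfl | rfl
    · rw [old hd, hg.addRow_apply hT hd]; exact hg.isOver d hd
    · rw [m0, hp]; cases ov d <;> rfl
    · rw [m1, hp, hover]; cases ov b <;> rfl
    · rw [m2, hp, hover, hover]; cases ov b <;> rfl
    · rw [m3, hp, hover, hover, hover]; cases ov b <;> rfl
  · intro p s hps
    by_cases h : p.1 = r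
    · rw [Tiling.addRow, if_pos h] at hps
      obtain rfl : p = ((r : ℤ), x) := Prod.ext h (hR _ hps)
      exact exists_mark hσ s
    · rw [Tiling.addRow, if_neg h] at hps
      obtain ⟨d, hd, hdp⟩ := hg.surj p s hps
      exact ⟨d, Finset.mem_union_left _ hd, (old hd).trans hdp⟩

end Mark

/-- A tiling in which the vertices with darts in `S` are drawn, the edges from `L` hang down, and the
other edges between these vertices are drawn as strands. -/
structure IsDrawing (σ e : Perm X) (ov : X → Bool) (N : ℕ) (L : List X) (S : Finset X)
    (T : ℤ × ℤ → Tile) (r h : ℕ) (o : ℕ → (ℤ × ℤ) × Side) (g : X → (ℤ × ℤ) × Side) : Prop where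
  sheet : IsSheet T r h N o (g '' S)
  marking : IsMarking σ ov T S g
  length : L.length = 2 * h
  size : r + h ≤ S.card
  width : 2 * h ≤ S.card
  origin : ∀ i d, L[i]? = some d → o i = g d
  edge_mem : ∀ d ∈ S, d ∉ L → e d ∈ S
  edge : ∀ d ∈ S, d ∉ L → Trace T (g d) (g (e d))

theorem isCross_crossRow {x : ℤ} {t : Tile} {j : ℤ} (h : IsCross (crossRow r x t j)) : j = x := by
  unfold crossRow at h
  split_ifs at h with h1 h2 h3 h4
  all_goals first | exact h4 | exact absurd h (by unfold IsCross; decide)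

theorem not_isCross_capRow {x : ℤ} (j : ℤ) : ¬ IsCross (capRow r x j) := by
  unfold capRow IsCross
  split_ifs <;> decide

theorem not_isCross_cupRow (j : ℤ) : ¬ IsCross (cupRow j) := by
  unfold cupRow IsCross
  split_ifs <;> decide

namespace IsDrawing

theorem origin_mem (hd : IsDrawing σ e ov N L S T r h o g) (hLS : ∀ x ∈ L, x ∈ S) {i : ℕ}
    (hi : i < 2 * h) : o i ∈ g '' S := by
  have hi' : i < L.length := by rw [hd.length]; exact hi
  exact ⟨L[i], Finset.mem_coe.2 (hLS _ (List.getElem_mem hi')),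
    (hd.origin i _ (List.getElem?_eq_getElem hi')).symm⟩

/-- One more row is paid for by the decrease of `h`: the sum `r + h` does not change. -/
theorem cap_step (hσ : FourValent σ e) {A B : List X} {a b : X}
    (hd : IsDrawing σ e ov N (A ++ a :: b :: B) S T r h o g)
    (hLS : ∀ x ∈ A ++ a :: b :: B, x ∈ S) (hab : e a = b) (hN : h ≤ N) :
    ∃ T' r' h' o' g', IsDrawing σ e ov N (A ++ B) S T' r' h' o' g' := by
  have hsize := hd.size
  have hwidth := hd.width
  have hlen := hd.length
  simp only [List.length_append, List.length_cons] at hlen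
  obtain ⟨h, rfl⟩ : ∃ h', h = h' + 1 := ⟨h - 1, by omega⟩
  have hba : e b = a := by rw [← hab, hσ.edge_edge]
  have haS : a ∈ S := hLS a (by simp)
  have hbS : b ∈ S := hLS b (by simp)
  set k := A.length with hk
  obtain ⟨hsheet, htrace⟩ := hd.sheet.cap (k := k) (by omega) hN
    fun i hi => hd.origin_mem hLS hi
  have hmark := hd.marking.addRow (R := capRow (h + 1) (k - (h + 1))) hd.sheet.rows
    not_isCross_capRow
  rw [hd.origin k a (by simp [hk]), hd.origin (k + 1) b (by simp [hk])] at htrace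
  have hcase {d : X} (hdL : d ∉ A ++ B) : d = b ∨ d = a ∨ d ∉ A ++ a :: b :: B := by
    simp only [List.mem_append, List.mem_cons] at hdL ⊢
    tauto
  refine ⟨_, _, _, _, _, hsheet, hmark, ?_, ?_, ?_, ?_, ?_, ?_⟩
  · simp only [List.length_append]; omega
  · omega
  · omega
  · intro i d hi
    unfold capOrigin
    split_ifs with h1
    · refine hd.origin i d ?_
      rw [List.getElem?_append_left h1] at hi ⊢
      exact hi
    · refine hd.origin (i + 2) d ?_
      obtain ⟨m, rfl⟩ : ∃ m, i = k + m := ⟨i - k, by omega⟩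
      rw [List.getElem?_append_right (by omega)] at hi
      rw [List.getElem?_append_right (by omega), show k + m + 2 - A.length = m + 2 by omega]
      rw [show k + m - A.length = m by omega] at hi
      simpa using hi
  · intro d hdS hdL
    rcases hcase hdL with rfl | rfl | h2
    · exact hba ▸ haS
    · exact hab ▸ hbS
    · exact hd.edge_mem d hdS h2
  · intro d hdS hdL
    rcases hcase hdL with rfl | rfl | h2
    · rw [hba]; exact htrace.symm
    · rw [hab]; exact htrace
    · exact (hd.edge d hdS h2).mono fun _ => hd.sheet.addRow_eq

variable [DecidableEq X]

theorem mark_image_subset (hS : ∀ x, σ x ∈ S → x ∈ S) {b : X} (hb : b ∉ S)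
    (p : ℤ × ℤ) :
    g '' S ⊆ mark σ g b p '' (S ∪ {b, σ b, σ (σ b), σ (σ (σ b))} : Finset X) := by
  rintro _ ⟨d, hd, rfl⟩
  exact ⟨d, Finset.mem_coe.2 (Finset.mem_union_left _ hd), mark_of_mem hS hb hd⟩

theorem mem_mark_image (hσ : FourValent σ e) {b : X} (p : ℤ × ℤ) (s : Side) :
    (p, s) ∈ mark σ g b p '' (S ∪ {b, σ b, σ (σ b), σ (σ (σ b))} : Finset X) := by
  obtain ⟨d, hd, h⟩ := exists_mark (S := S) (g := g) (b := b) (p := p) hσ s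
  exact ⟨d, Finset.mem_coe.2 hd, h⟩

/-- The half circle takes the upper dart `b` of the new crossing round to the left of the three
others, so that all four hang down in cyclic order. Two rows are used and `h` becomes 2, in exchange
for four new darts. -/
theorem start_step (hσ : FourValent σ e) (hov : ∀ x, ov (σ x) = !ov x)
    (hd : IsDrawing σ e ov N [] S T r h o g) (hS : ∀ x, σ x ∈ S → x ∈ S)
    (hS' : ∀ x ∈ S, σ x ∈ S) {b : X} (hb : b ∉ S) (hN : 2 ≤ N) :
    ∃ T' r' h' o' g', IsDrawing σ e ov N [b, σ b, σ (σ b), σ (σ (σ b))]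
      (S ∪ {b, σ b, σ (σ b), σ (σ (σ b))}) T' r' h' o' g' := by
  obtain rfl : h = 0 := by have := hd.length; simp at this; omega
  have hcard := card_union_orbit hσ hS hb
  have hsize := hd.size
  -- The row below the half circle and column `k - h` with `k = 1`, `h = 1`, in the form in which
  -- `IsSheet.cross` yields it.
  set p : ℤ × ℤ := (((r + 1 : ℕ) : ℤ), ((1 : ℕ) : ℤ) - ((1 : ℕ) : ℤ)) with hp
  have hp0 : p = ((r : ℤ) + 1, 0) := by simp [hp]
  have hmem (s : Side) := mem_mark_image (S := S) (g := g) (b := b) hσ p s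
  have hsheet1 := hd.sheet.cup (by omega) (mark_image_subset hS hb p) (hp0 ▸ hmem .north)
  have hsheet2 := hsheet1.cross (k := 1) (by omega) (isCross_crossTile (ov b)) (by omega) subset_rfl
    (fun i hi hi1 => by
      obtain rfl : i = 0 := by omega
      exact hp0 ▸ hmem .north) (fun s => hmem s)
  have hmark := (hd.marking.addRow (R := cupRow) hd.sheet.rows not_isCross_cupRow).addRow_mark hσ
    hov hsheet1.rows hS hS' hb (R := crossRow 1 (((1 : ℕ) : ℤ) - ((1 : ℕ) : ℤ)) (crossTile (ov b)))
    (crossRow_self (by simp)) fun j => isCross_crossRow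
  refine ⟨_, _, _, _, _, hsheet2, hmark, by simp, ?_, ?_, ?_, ?_, ?_⟩
  · omega
  · omega
  · intro i d hi
    rcases i with _ | _ | _ | _ | i
    · obtain rfl : b = d := by simpa using hi
      rw [mark_zero]
      simp [crossOrigin, cupOrigin, hp0]
    · obtain rfl : σ b = d := by simpa using hi
      rw [mark_one hσ]
      simp [crossOrigin, hp0]
    · obtain rfl : σ (σ b) = d := by simpa using hi
      rw [mark_two hσ]
      simp [crossOrigin, hp0]
    · obtain rfl : σ (σ (σ b)) = d := by simpa using hi
      rw [mark_three hσ]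
      simp [crossOrigin, hp0]
    · simp at hi
  · intro d hdS hdL
    rcases Finset.mem_union.1 hdS with h | h
    · exact Finset.mem_union_left _ (hd.edge_mem d h (by simp))
    · exact absurd (by simpa using h) hdL
  · intro d hdS hdL
    rcases Finset.mem_union.1 hdS with h | h
    · rw [mark_of_mem hS hb h, mark_of_mem hS hb (hd.edge_mem d h (by simp))]
      exact ((hd.edge d h (by simp)).mono fun _ => hd.sheet.addRow_eq).mono
        fun _ => hsheet1.addRow_eq
    · exact absurd (by simpa using h) hdL

/-- Both `r + h` and `2 * h` grow by two, while four darts are added to `S`. -/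
theorem attach_step (hσ : FourValent σ e) (hov : ∀ x, ov (σ x) = !ov x) {A B : List X} {a b : X}
    (hd : IsDrawing σ e ov N (A ++ a :: B) S T r h o g) (hS : ∀ x, σ x ∈ S → x ∈ S)
    (hS' : ∀ x ∈ S, σ x ∈ S) (hLS : ∀ x ∈ A ++ a :: B, x ∈ S) (hab : e a = b) (hb : b ∉ S)
    (hN : h + 1 ≤ N) :
    ∃ T' r' h' o' g', IsDrawing σ e ov N (A ++ σ b :: σ (σ b) :: σ (σ (σ b)) :: B)
      (S ∪ {b, σ b, σ (σ b), σ (σ (σ b))}) T' r' h' o' g' := by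
  have hcard := card_union_orbit hσ hS hb
  have hsize := hd.size
  have hwidth := hd.width
  have hlen := hd.length
  simp only [List.length_append, List.length_cons] at hlen
  have hba : e b = a := by rw [← hab, hσ.edge_edge]
  have haS : a ∈ S := hLS a (by simp)
  set k := A.length with hk
  set p : ℤ × ℤ := ((r : ℤ), (k : ℤ) - h) with hp
  have hsheet := hd.sheet.cross (k := k) (by omega) (isCross_crossTile (ov b)) hN
    (mark_image_subset hS hb p)
    (fun i hi _ => mark_image_subset hS hb p (hd.origin_mem hLS hi))
    (fun s => mem_mark_image (S := S) (g := g) (b := b) hσ p s)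
  have hmark := hd.marking.addRow_mark hσ hov hd.sheet.rows hS hS' hb
    (R := crossRow h ((k : ℤ) - h) (crossTile (ov b)))
    (crossRow_self (by omega)) fun j => isCross_crossRow
  have htrace : Trace (Tiling.addRow T r (crossRow h ((k : ℤ) - h) (crossTile (ov b)))) (g a)
      (p, .north) := by
    have h1 := hd.sheet.strand_addRow (R := crossRow h ((k : ℤ) - h) (crossTile (ov b)))
      (i := k) (by omega)
    rwa [hd.origin k a (by simp [hk])] at h1
  have hcase {d : X} (hdS : d ∈ S ∪ {b, σ b, σ (σ b), σ (σ (σ b))})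
      (hdL : d ∉ A ++ σ b :: σ (σ b) :: σ (σ (σ b)) :: B) :
      d = b ∨ d = a ∨ (d ∈ S ∧ d ∉ A ++ a :: B) := by
    simp only [Finset.mem_union, Finset.mem_insert, Finset.mem_singleton, List.mem_append,
      List.mem_cons] at hdS hdL ⊢
    tauto
  refine ⟨_, _, _, _, _, hsheet, hmark, ?_, ?_, ?_, ?_, ?_, ?_⟩
  · simp only [List.length_append, List.length_cons]; omega
  · omega
  · omega
  · intro i d hi
    have hmem (j : ℕ) (d : X) (hj : (A ++ a :: B)[j]? = some d) :
        o j = mark σ g b p d := by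
      rw [hd.origin j d hj, mark_of_mem hS hb (hLS d (List.mem_of_getElem? hj))]
    unfold crossOrigin
    split_ifs with h1 h2 h3 h4
    · refine hmem i d ?_
      rw [List.getElem?_append_left h1] at hi ⊢
      exact hi
    · subst h2
      obtain rfl : σ b = d := by simpa [hk] using hi
      rw [mark_one hσ]
    · subst h3
      obtain rfl : σ (σ b) = d := by simpa [hk] using hi
      rw [mark_two hσ]
    · subst h4
      obtain rfl : σ (σ (σ b)) = d := by simpa [hk] using hi
      rw [mark_three hσ]
    · refine hmem (i - 2) d ?_
      obtain ⟨m, rfl⟩ : ∃ m, i = k + (m + 3) := ⟨i - k - 3, by omega⟩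
      rw [List.getElem?_append_right (by omega)] at hi
      rw [List.getElem?_append_right (by omega), show k + (m + 3) - 2 - A.length = m + 1 by omega]
      rw [show k + (m + 3) - A.length = m + 3 by omega] at hi
      simpa using hi
  · intro d hdS hdL
    rcases hcase hdS hdL with rfl | rfl | ⟨h1, h2⟩
    · exact Finset.mem_union_left _ (hba ▸ haS)
    · rw [hab]; exact Finset.mem_union_right _ (by simp)
    · exact Finset.mem_union_left _ (hd.edge_mem d h1 h2)
  · intro d hdS hdL
    rcases hcase hdS hdL with rfl | rfl | ⟨h1, h2⟩
    · rw [hba, mark_zero, mark_of_mem hS hb haS]; exact htrace.symm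
    · rw [hab, mark_zero, mark_of_mem hS hb haS]; exact htrace
    · rw [mark_of_mem hS hb h1, mark_of_mem hS hb (hd.edge_mem d h1 h2)]
      exact (hd.edge d h1 h2).mono fun _ => hd.sheet.addRow_eq

end IsDrawing

theorem _root_.Hypermap.Reach.subset [DecidableEq X] (h : Reach σ e L S) : ∀ x ∈ L, x ∈ S := by
  induction h with
  | nil => simp
  | start _ _ _ => simp
  | attach _ _ _ ih =>
    intro x hx
    have := ih x
    simp only [Finset.mem_union, Finset.mem_insert, Finset.mem_singleton, List.mem_append,
      List.mem_cons] at hx this ⊢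
    tauto
  | cap _ _ ih =>
    intro x hx
    refine ih x ?_
    simp only [List.mem_append, List.mem_cons] at hx ⊢
    tauto

/-- Half the number of darts is wide enough, because `2 * h` never exceeds the number of darts
drawn. -/
theorem exists_isDrawing [Fintype X] [DecidableEq X] (hσ : FourValent σ e)
    (hov : ∀ x, ov (σ x) = !ov x) (hR : Reach σ e L S) :
    ∃ T r h o g, IsDrawing σ e ov (Fintype.card X / 2) L S T r h o g := by
  induction hR with
  | nil =>
    exact ⟨_, 0, 0, _, fun _ => ((0, 0), .east), isSheet_blank _ (fun _ => ((0, 0), .east)) _,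
      ⟨by simp, by simp, by simp, by simp, fun _ _ h => absurd rfl h.ne_blank⟩, rfl, by simp,
      by simp, by simp, by simp, by simp⟩
  | @start S d hR hdS ih =>
    obtain ⟨T, r, h, o, g, hd⟩ := ih
    have h1 := card_union_orbit hσ (fun x => hR.mem_of_rotation_mem hσ) hdS
    have h2 := Finset.card_le_univ (S ∪ {d, σ d, σ (σ d), σ (σ (σ d))})
    exact hd.start_step hσ hov (fun x => hR.mem_of_rotation_mem hσ) (hR.rotation_mem hσ) hdS
      (by omega)
  | @attach S A B a b hR hab hb ih =>
    obtain ⟨T, r, h, o, g, hd⟩ := ih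
    have h1 := card_union_orbit hσ (fun x => hR.mem_of_rotation_mem hσ) hb
    have h2 := Finset.card_le_univ (S ∪ {b, σ b, σ (σ b), σ (σ (σ b))})
    have h3 := hd.width
    exact hd.attach_step hσ hov (fun x => hR.mem_of_rotation_mem hσ) (hR.rotation_mem hσ) hR.subset
      hab hb (by omega)
  | @cap S A B a b hR hab ih =>
    obtain ⟨T, r, h, o, g, hd⟩ := ih
    have h2 := Finset.card_le_univ S
    have h3 := hd.width
    exact hd.cap_step hσ hR.subset hab (by omega)

end Tiling

/-! ### The mosaic of a finished tiling and its link diagram -/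

namespace Tiling

open Hypermap

variable {T : ℤ × ℤ → Tile} {r h N n : ℕ} {o : ℕ → (ℤ × ℤ) × Side} {Q : Set ((ℤ × ℤ) × Side)}

theorem isCross_iff (t : Tile) (s : Side) : IsCross t ↔ t.rot (t.rot s) ≠ s := by
  unfold IsCross
  revert s
  cases t <;> decide

theorem joins_of_hasPoint {t : Tile} {s : Side} (hs : t.HasPoint s) (ht : ¬ IsCross t) :
    Joins t s (t.rot s) := by
  rw [isCross_iff t s, not_not] at ht
  exact ⟨rfl, ht, hs⟩

theorem not_hasPoint_blank (s : Side) : ¬ Tile.blank.HasPoint s := fun h => h rfl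

/-- The mosaic that shows the rows `0, …, n - 1` and the columns `-N, …, n - 1 - N` of a tiling. -/
def toMosaic (T : ℤ × ℤ → Tile) (N n : ℕ) : Mosaic n := fun i j => T (i, (j : ℤ) - N)

theorem tileAt_toMosaic (hT : IsSheet T r h N o Q) (hr : r ≤ n) (hN : 2 * N ≤ n) (p : ℤ × ℤ) :
    (toMosaic T N n).tileAt p = T (p.1, p.2 - N) := by
  unfold Mosaic.tileAt
  split_ifs with hp
  · simp only [toMosaic]
    rw [Int.toNat_of_nonneg hp.1.1, Int.toNat_of_nonneg hp.2.1]
  · by_contra hne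
    have h1 := hT.rows _ (Ne.symm hne)
    have h2 := hT.narrow _ (Ne.symm hne)
    simp only at h1 h2
    omega

theorem suitablyConnected_toMosaic (hT : IsSheet T r 0 N o Q) (hr : r ≤ n) (hN : 2 * N ≤ n) :
    (toMosaic T N n).SuitablyConnected := by
  rintro ⟨i, j⟩ s hs
  rw [tileAt_toMosaic hT hr hN] at hs ⊢
  cases s
  · have := (hT.horizontal i (j - N)).1 hs
    simpa [Side.step, Side.flip, add_sub_right_comm] using this
  · have hi : i - 1 ≠ (r : ℤ) - 1 := by
      intro hi
      have hb : T (i, j - N) ≠ Tile.blank := fun hb => not_hasPoint_blank _ (hb ▸ hs)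
      have := (hT.rows _ hb).2
      simp only at this
      omega
    have := (hT.vertical (i - 1) (j - N) hi).2 (by simpa using hs)
    simpa [Side.step, Side.flip, sub_eq_add_neg] using this
  · have := (hT.horizontal i (j - 1 - N)).2
      (by rw [show j - 1 - N + 1 = j - N by ring]; exact hs)
    simpa [Side.step, Side.flip, sub_eq_add_neg] using this
  · have hi : i ≠ (r : ℤ) - 1 := by
      rintro rfl
      have := (hT.bottom _).1 hs
      push_cast at this
      omega
    have := (hT.vertical i (j - N) hi).1 hs
    simpa [Side.step, Side.flip] using this

/-- The connection point of the tiling that is shown by a dart of the mosaic. -/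
def shift {M : Mosaic n} (N : ℕ) (x : M.MosaicDart) : (ℤ × ℤ) × Side :=
  ((x.1.1.1, x.1.1.2 - N), x.1.2)

theorem shift_injective {M : Mosaic n} : Function.Injective (shift (M := M) N) := by
  rintro ⟨⟨⟨i, j⟩, s⟩, hx⟩ ⟨⟨⟨i', j'⟩, s'⟩, hx'⟩ h
  simp only [shift, Prod.mk.injEq, sub_left_inj] at h
  obtain ⟨⟨rfl, rfl⟩, rfl⟩ := h
  rfl

section Diagram

variable (hT : IsSheet T r 0 N o Q) (hr : r ≤ n) (hN : 2 * N ≤ n)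

/-- The link diagram drawn by a suitably connected tiling. -/
def diagram : LinkDiagram := (toMosaic T N n).toDiagram (suitablyConnected_toMosaic hT hr hN)

/-- The connection point of the tiling that is shown by a dart. -/
def point (x : (diagram hT hr hN).Dart) : (ℤ × ℤ) × Side :=
  shift (M := toMosaic T N n) N x

theorem point_injective : Function.Injective (point hT hr hN) := shift_injective

theorem tile_point (x : (diagram hT hr hN).Dart) :
    (toMosaic T N n).tileAt x.1.1 = T (point hT hr hN x).1 :=
  tileAt_toMosaic hT hr hN _

theorem hasPoint_point (x : (diagram hT hr hN).Dart) :
    (T (point hT hr hN x).1).HasPoint (point hT hr hN x).2 := by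
  rw [← tile_point hT hr hN]; exact x.2

theorem exists_point {y : (ℤ × ℤ) × Side} (hy : (T y.1).HasPoint y.2) :
    ∃ x, point hT hr hN x = y := by
  obtain ⟨⟨i, j⟩, s⟩ := y
  refine ⟨⟨((i, j + N), s), ?_⟩, ?_⟩
  · rw [tileAt_toMosaic hT hr hN]
    simpa using hy
  · simp [point, shift]

theorem point_edge (x : (diagram hT hr hN).Dart) :
    point hT hr hN ((diagram hT hr hN).edge x) = mate (point hT hr hN x) := by
  obtain ⟨⟨⟨i, j⟩, s⟩, hx⟩ := x
  change ((i + s.step.1, j + s.step.2 - N), s.flip) = ((i + s.step.1, j - N + s.step.2), s.flip)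
  rw [add_sub_right_comm]

theorem point_next (x : (diagram hT hr hN).Dart) :
    point hT hr hN ((diagram hT hr hN).next x) = turn T (point hT hr hN x) := by
  have h := tile_point hT hr hN x
  rw [turn, ← h]
  rfl

theorem isOver_point (x : (diagram hT hr hN).Dart) :
    (diagram hT hr hN).isOver x = (T (point hT hr hN x).1).isOver (point hT hr hN x).2 := by
  rw [← tile_point hT hr hN]; rfl

theorem isCrossing_point (x : (diagram hT hr hN).Dart) :
    (diagram hT hr hN).IsCrossing x ↔ IsCross (T (point hT hr hN x).1) := by
  rw [isCross_iff _ (point hT hr hN x).2, LinkDiagram.IsCrossing,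
    ← (point_injective hT hr hN).ne_iff, point_next, point_next]
  exact not_congr ⟨fun h => congrArg Prod.snd h, fun h => Prod.ext rfl h⟩

theorem exists_trace {x : (diagram hT hr hN).Dart} {z : (ℤ × ℤ) × Side}
    (h : Trace T (point hT hr hN x) z) :
    ∃ w, point hT hr hN w = z ∧ (diagram hT hr hN).Trace x w := by
  induction h with
  | mate => exact ⟨_, point_edge hT hr hN x, LinkDiagram.Trace.edge⟩
  | step _ hs ih =>
    obtain ⟨w, hw, hxw⟩ := ih
    refine ⟨_, ?_, hxw.step ?_⟩
    · rw [point_edge, point_next, turn, hw, hs.1]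
    · rw [isCrossing_point, hw, isCross_iff _ _, hs.1, hs.2.1, not_not]

theorem trace_of_trace {x y : (diagram hT hr hN).Dart}
    (h : Trace T (point hT hr hN x) (point hT hr hN y)) : (diagram hT hr hN).Trace x y := by
  obtain ⟨w, hw, hxw⟩ := exists_trace hT hr hN h
  rwa [point_injective hT hr hN hw] at hxw

/-- This is the purpose of `cover`: it excludes closed curves that avoid `Q`. -/
theorem exists_sameComponent (hQ : ∀ y ∈ Q, (T y.1).HasPoint y.2) (x : (diagram hT hr hN).Dart)
    (hx : ¬ (diagram hT hr hN).IsCrossing x) :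
    ∃ y, point hT hr hN y ∈ Q ∧ (diagram hT hr hN).SameComponent x y := by
  have hj := joins_of_hasPoint (hasPoint_point hT hr hN x)
    (fun h => hx ((isCrossing_point hT hr hN x).2 h))
  obtain ⟨y, hy, hyx⟩ := hT.cover _ _ _ hj
  obtain ⟨y, rfl⟩ := exists_point hT hr hN (hQ y hy)
  refine ⟨y, hy, ?_⟩
  rcases hyx with h | h
  · exact (trace_of_trace hT hr hN h).sameComponent.symm _ _
  · have h1 : (diagram hT hr hN).Trace y ((diagram hT hr hN).next x) :=
      trace_of_trace hT hr hN (by rw [point_next]; exact h)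
    have h2 := (diagram hT hr hN).sameComponent_opposite x
    rw [LinkDiagram.opposite, if_neg hx] at h2
    exact h2.trans _ _ _ (h1.sameComponent.symm _ _)

end Diagram

end Tiling

/-! ### Recovering the diagram from the mosaic, and the bound -/

namespace LinkDiagram

open Hypermap Tiling Equiv.Perm

theorem IsCrossing.opposite {D : LinkDiagram} {x : D.Dart} :
    D.IsCrossing (D.opposite x) ↔ D.IsCrossing x := by
  have hn {x : D.Dart} : D.IsCrossing (D.next x) ↔ D.IsCrossing x :=
    D.next.injective.ne_iff
  unfold LinkDiagram.opposite
  split_ifs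
  · rw [hn, hn]
  · rw [hn]

/-- A remaining vertex of degree two is alone on its circle, so being a crossing is constant along
each link component. -/
theorem isCrossing_of_everyComponentCrosses {D : LinkDiagram} (hD : D.EveryComponentCrosses)
    (h : ∀ x, ¬ D.IsCrossing x → D.edge x = D.next x) (x : D.Dart) : D.IsCrossing x := by
  have hn {x : D.Dart} : D.IsCrossing (D.next x) ↔ D.IsCrossing x :=
    D.next.injective.ne_iff
  have he (x : D.Dart) : D.IsCrossing (D.edge x) ↔ D.IsCrossing x := by
    have key (y : D.Dart) (hy : ¬ D.IsCrossing y) : ¬ D.IsCrossing (D.edge y) := by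
      rwa [h y hy, hn]
    refine ⟨fun h1 => by_contra fun h2 => key x h2 h1, fun h1 => by_contra fun h2 => key _ h2 ?_⟩
    rwa [D.edge_edge]
  obtain ⟨y, hxy, hy⟩ := hD x
  have : D.IsCrossing x ↔ D.IsCrossing y := by
    clear hy
    induction hxy with
    | refl => rfl
    | symm _ _ _ ih => exact ih.symm
    | trans _ _ _ _ _ ih ih' => exact ih.trans ih'
    | rel x y h =>
      rcases h with rfl | rfl
      · exact (he x).symm
      · exact IsCrossing.opposite.symm
  exact this.2 hy

/-- There are twice as many darts as edges, which turns `V - E + F` into the symmetric sum of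
`Spherical`. -/
theorem Planar.spherical {D : LinkDiagram} (hD : D.Planar) : Spherical D.next D.edge := by
  have h1 := D.card_edge
  have h2 : numPieces D.next D.edge = Nat.card D.Piece := by
    have : connected D.next D.edge = connected D.edge D.next :=
      le_antisymm (connected_le (connected_right _ _) (connected_left _ _))
        (connected_le (connected_right _ _) (connected_left _ _))
    rw [numPieces, this]; rfl
  have h3 : numCycles D.next = Nat.card D.Vertex := rfl
  have h4 : numCycles D.edge = Nat.card D.Edge := rfl
  have h5 : numCycles (D.next * D.edge) = Nat.card D.Face := rfl
  rw [Planar] at hD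
  rw [Spherical, h2, h3, h4, h5]
  omega

theorem equivalent_symm {D D' : LinkDiagram} (h : D.Equivalent D') : D'.Equivalent D :=
  Relation.EqvGen.symm _ _ h

theorem equivalent_trans {D D' D'' : LinkDiagram} (h : D.Equivalent D') (k : D'.Equivalent D'') :
    D.Equivalent D'' :=
  Relation.EqvGen.trans _ _ _ h k

/-- A planar diagram without vertices of degree two is drawn on a mosaic whose size is the number
of darts. -/
theorem exists_mosaic (D : LinkDiagram) (hD : D.Planar) (hc : ∀ x, D.IsCrossing x) :
    ∃ (M : Mosaic (Nat.card D.Dart)) (hM : M.SuitablyConnected),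
      (M.toDiagram hM).Equivalent D := by
  classical
  have := D.finite_dart
  have := Fintype.ofFinite D.Dart
  have hσ : FourValent D.next D.edge :=
    ⟨D.edge_edge, D.edge_ne, D.next_four, D.next_ne, hc⟩
  obtain ⟨T, r, h, o, g, hd⟩ := exists_isDrawing hσ (ov := D.isOver)
    (fun x => D.over_next x (hc x)) (reach_univ hσ hD.spherical)
  obtain rfl : h = 0 := by have := hd.length; simp at this; omega
  have hr : r ≤ Nat.card D.Dart := by
    have := hd.size
    rw [Finset.card_univ] at this
    rw [Nat.card_eq_fintype_card]; omega
  have hN : 2 * (Fintype.card D.Dart / 2) ≤ Nat.card D.Dart := by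
    rw [Nat.card_eq_fintype_card]; omega
  set E := diagram hd.sheet hr hN with hE
  set pt := point hd.sheet hr hN with hpt
  have hcross (x : D.Dart) : IsCross (T (g x).1) := hd.marking.isCross x (Finset.mem_univ x)
  have hgpt (x : D.Dart) : (T (g x).1).HasPoint (g x).2 := hasPoint_of_isCross (hcross x) _
  have hQ : ∀ y ∈ g '' (Finset.univ : Finset D.Dart), (T y.1).HasPoint y.2 := by
    rintro _ ⟨x, -, rfl⟩
    exact hgpt x
  choose k hk using fun x => exists_point hd.sheet hr hN (hgpt x)
  have hkc (x : D.Dart) : E.IsCrossing (k x) := by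
    rw [isCrossing_point, hk]; exact hcross x
  have hECC : E.EveryComponentCrosses := by
    intro x
    by_cases hx : E.IsCrossing x
    · exact ⟨x, Relation.EqvGen.refl _, hx⟩
    · obtain ⟨y, ⟨d, -, hdy⟩, hxy⟩ := exists_sameComponent hd.sheet hr hN hQ x hx
      refine ⟨y, hxy, ?_⟩
      rw [isCrossing_point, ← hdy]; exact hcross d
  obtain ⟨E', f, hEE', hf, hf1, -, -, hf2⟩ := E.exists_reduction
  have hE'c := isCrossing_of_everyComponentCrosses (hf2 hECC) hf1
  refine ⟨_, _, equivalent_trans hEE' (Relation.EqvGen.rel _ _ (Move.isomorphic ?_))⟩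
  -- The isomorphism sends a dart `x` of `D` to the dart that shows the point `g x` after the
  -- reduction.
  choose φ hφ using fun x => hf.mem_range (k x) (hkc x)
  have hptφ (x : D.Dart) : pt (f (φ x)) = g x := by rw [hφ]; exact hk x
  have hinj : Function.Injective (fun y => pt (f y)) :=
    (point_injective hd.sheet hr hN).comp hf.injective
  refine ⟨φ, ?_, ?_, fun x => ?_, fun x => hinj ?_, fun x _ => ?_⟩
  · intro x y hxy
    refine hd.marking.injOn (by simp) (by simp) ?_
    rw [← hptφ, ← hptφ, hxy]
  · rw [Set.compl_empty, Set.range_eq_univ]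
    intro y
    have hy := (hf.isCrossing_iff y).2 (hE'c y)
    rw [isCrossing_point] at hy
    obtain ⟨d, -, hdy⟩ := hd.marking.surj _ (pt (f y)).2 hy
    exact ⟨d, hinj ((hptφ d).trans hdy)⟩
  · refine hf.injective ((hf.trace (φ x)).eq_of_isCrossing (trace_of_trace hd.sheet hr hN ?_)
      ((hf.isCrossing_iff _).2 (hE'c _)) ((hf.isCrossing_iff _).2 (hE'c _))).symm
    have := hd.edge x (Finset.mem_univ x) (by simp)
    rwa [← hptφ, ← hptφ] at this
  · change pt (f (φ (D.next x))) = pt (f (E'.next (φ x)))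
    rw [hptφ, hf.next, hpt, point_next, ← hpt, hptφ]
    exact hd.marking.next x (Finset.mem_univ x)
  · rw [hf.isOver _ (hE'c _), isOver_point, ← hpt, hptφ]
    exact (hd.marking.isOver x (Finset.mem_univ x)).symm

/-- A tiling that shows a circle. -/
theorem exists_circle : ∃ (M : Mosaic 2) (hM : M.SuitablyConnected),
    (M.toDiagram hM).IsKnot ∧ ∀ x, ¬ (M.toDiagram hM).IsCrossing x := by
  -- A half circle is closed by a cap in the next row; `Q` holds the two points where they meet.
  set Q : Set ((ℤ × ℤ) × Side) := {((1, 0), .north), ((1, -1), .north)} with hQ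
  have h0 := isSheet_blank 1 (cupOrigin 0) Q
  have h1 := h0.cup le_rfl subset_rfl (by simp [hQ])
  obtain ⟨h2, htr⟩ := IsSheet.cap (h := 0) (k := 0) h1 (by simp) le_rfl (by
    intro i hi
    obtain rfl | rfl : i = 0 ∨ i = 1 := by omega
    · simp [hQ, cupOrigin]
    · simp [hQ, cupOrigin])
  set T := Tiling.addRow (Tiling.addRow (fun _ => Tile.blank) 0 cupRow) (0 + 1)
    (capRow (0 + 1) (((0 : ℕ) : ℤ) - (((0 : ℕ) : ℤ) + 1))) with hT
  have hnc (p : ℤ × ℤ) : ¬ IsCross (T p) := by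
    rw [hT, Tiling.addRow, Tiling.addRow]
    split_ifs
    · exact not_isCross_capRow _
    · exact not_isCross_cupRow _
    · exact fun h => h.ne_blank rfl
  have hQp : ∀ y ∈ Q, (T y.1).HasPoint y.2 := by
    rintro y (rfl | rfl)
    · simp [hT, Tiling.addRow, capRow]; decide
    · simp [hT, Tiling.addRow, capRow]; decide
  have hc (x) : ¬ (diagram h2 (n := 2) le_rfl le_rfl).IsCrossing x := by
    rw [isCrossing_point]; exact hnc _
  refine ⟨toMosaic T 1 2, suitablyConnected_toMosaic h2 le_rfl le_rfl, ⟨?_, ?_⟩, hc⟩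
  · obtain ⟨x, -⟩ := exists_point h2 (n := 2) le_rfl le_rfl (hQp ((1, 0), .north) (by simp [hQ]))
    exact ⟨x⟩
  · have htr' : Tiling.Trace T ((1, 0), .north) ((1, -1), .north) := by simpa [cupOrigin] using htr
    obtain ⟨u, hu⟩ := exists_point h2 (n := 2) le_rfl le_rfl (hQp ((1, 0), .north) (by simp [hQ]))
    have key (x : (diagram h2 (n := 2) le_rfl le_rfl).Dart) :
        (diagram h2 (n := 2) le_rfl le_rfl).SameComponent x u := by
      obtain ⟨y, hy, hxy⟩ := exists_sameComponent h2 le_rfl le_rfl hQp x (hc x)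
      refine hxy.trans _ _ _ ?_
      rcases hy with hy | hy
      · rw [point_injective _ _ _ (hy.trans hu.symm)]; exact Relation.EqvGen.refl _
      · refine ((trace_of_trace h2 le_rfl le_rfl ?_).sameComponent).symm _ _
        rw [hu, hy]; exact htr'
    exact fun x y => (key x).trans _ _ _ ((key y).symm _ _)

/-- A diagram that consists of a circle with one vertex of degree two has only two darts. -/
theorem IsKnot.eq_or_eq {D : LinkDiagram} (hD : D.IsKnot) (hc : ∀ x, ¬ D.IsCrossing x)
    (h : ∀ x, D.edge x = D.next x) (x y : D.Dart) : y = x ∨ y = D.edge x := by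
  have key {a b : D.Dart} (hab : D.SameComponent a b) :
      (a = x ∨ a = D.edge x) ↔ (b = x ∨ b = D.edge x) := by
    have he (a : D.Dart) : (a = x ∨ a = D.edge x) ↔ (D.edge a = x ∨ D.edge a = D.edge x) := by
      rw [edge_eq_iff, D.edge.injective.eq_iff, or_comm]
    induction hab with
    | refl => rfl
    | symm _ _ _ ih => exact ih.symm
    | trans _ _ _ _ _ ih ih' => exact ih.trans ih'
    | rel a b hab =>
      rcases hab with rfl | rfl
      · exact he a
      · rw [LinkDiagram.opposite, if_neg (hc a), ← h a]; exact he a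
  exact (key (hD.2 x y)).1 (Or.inl rfl)

/-- Both diagrams consist of two darts that reversal and rotation alike exchange. -/
theorem isomorphic_of_isKnot {D D' : LinkDiagram} (hD : D.IsKnot) (hD' : D'.IsKnot)
    (hc : ∀ x, ¬ D.IsCrossing x) (hc' : ∀ x, ¬ D'.IsCrossing x)
    (h : ∀ x, D.edge x = D.next x) (h' : ∀ x, D'.edge x = D'.next x) : D.Isomorphic D' := by
  classical
  obtain ⟨x⟩ := hD.1
  obtain ⟨x'⟩ := hD'.1
  have hx := hD.eq_or_eq hc h x
  have hx' := hD'.eq_or_eq hc' h' x'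
  have hn := D.edge_ne x
  have hn' := D'.edge_ne x'
  have hedge (y : D'.Dart) : (if D'.edge y = x' then x else D.edge x) =
      D.edge (if y = x' then x else D.edge x) := by
    rcases hx' y with rfl | rfl
    · simp [hn']
    · simp [hn', D'.edge_edge, D.edge_edge]
  refine ⟨fun y => if y = x' then x else D.edge x, ?_, ?_, hedge, fun y => ?_, fun y hy =>
    absurd hy (hc' y)⟩
  · intro y z hyz
    rcases hx' y with rfl | rfl <;> rcases hx' z with rfl | rfl
    · rfl
    · simp only [if_true, if_neg hn'] at hyz; exact absurd hyz.symm hn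
    · simp only [if_true, if_neg hn'] at hyz; exact absurd hyz hn
    · rfl
  · rw [Set.compl_empty, Set.range_eq_univ]
    intro y
    rcases hx y with rfl | rfl
    · exact ⟨x', by simp⟩
    · exact ⟨D'.edge x', by simp [hn']⟩
  · rw [← h', ← h]; exact hedge y

/-- Every dart that is kept lies at a crossing of `D`, where it is one of four powers of `next`
applied to a chosen dart. -/
theorem card_le_of_reduction {D D' : LinkDiagram} {f : D'.Dart → D.Dart} (hf : Reduction D D' f)
    (hc : ∀ x, D'.IsCrossing x) : Nat.card D'.Dart ≤ 4 * D.numCrossings := by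
  have := D.finite_dart
  have h4 : D.next ^ 4 = 1 := Equiv.ext D.next_four
  have key (y : D'.Dart) : ∃ q : {v : D.Vertex // ∃ d, D.IsCrossing d ∧ v = Quotient.mk _ d} × Fin 4,
      (D.next ^ (q.2 : ℕ)) (Quotient.out q.1.1) = f y := by
    have hs : D.next.SameCycle (Quotient.out (Quotient.mk (SameCycle.setoid D.next) (f y))) (f y) :=
      Quotient.exact (Quotient.out_eq (Quotient.mk (SameCycle.setoid D.next) (f y)))
    obtain ⟨i, -, hi⟩ := hs.exists_pow_eq'
    refine ⟨(⟨Quotient.mk _ (f y), f y, (hf.isCrossing_iff y).2 (hc y), rfl⟩,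
      ⟨i % 4, Nat.mod_lt _ (by norm_num)⟩), ?_⟩
    rw [pow_eq_pow_mod i h4] at hi
    exact hi
  choose q hq using key
  have hinj : Function.Injective q := fun y z hyz =>
    hf.injective (by rw [← hq y, ← hq z, hyz])
  have : Finite D.Vertex := Quotient.finite _
  refine (Nat.card_le_card_of_injective q hinj).trans ?_
  rw [Nat.card_prod, Nat.card_eq_fintype_card (α := Fin 4), Fintype.card_fin, mul_comm]
  rfl

theorem exists_isMosaicNumber {D : LinkDiagram} {m : ℕ} {M : Mosaic m} (hM : M.SuitablyConnected)
    (h : (M.toDiagram hM).Equivalent D) : ∃ n, D.IsMosaicNumber n ∧ n ≤ m := by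
  classical
  have hex : ∃ m, m ∈ {m : ℕ | ∃ (M : Mosaic m) (hM : M.SuitablyConnected),
    (M.toDiagram hM).Equivalent D} := ⟨m, M, hM, h⟩
  exact ⟨Nat.find hex, ⟨Nat.find_spec hex, fun k hk => Nat.find_min' hex hk⟩,
    Nat.find_min' hex ⟨M, hM, h⟩⟩

end LinkDiagram

theorem mainTheorem3 (D : LinkDiagram) (hD : D.Planar)
    (hcomp : D.IsKnot ∨ D.EveryComponentCrosses) (c : ℕ) (hc : D.numCrossings = c) :
    ∃ n : ℕ, D.IsMosaicNumber n ∧ n ≤ 4 * c + 2 := by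
  obtain ⟨D', f, hDD', hf, hf1, hplanar, hknot, hcross⟩ := D.exists_reduction
  by_cases hECC : D.EveryComponentCrosses
  · have hc' := LinkDiagram.isCrossing_of_everyComponentCrosses (hcross hECC) hf1
    obtain ⟨M, hM, hMD⟩ := D'.exists_mosaic (hplanar hD) hc'
    obtain ⟨n, hn, hnm⟩ := LinkDiagram.exists_isMosaicNumber hM
      (LinkDiagram.equivalent_trans hMD (LinkDiagram.equivalent_symm hDD'))
    have := LinkDiagram.card_le_of_reduction hf hc'
    exact ⟨n, hn, by omega⟩
  · have hk := hcomp.resolve_right hECC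
    -- A knot with at least one crossing would fall under the first case, so here `D'` is a bare
    -- circle.
    have hnc (x : D'.Dart) : ¬ D'.IsCrossing x := fun hx =>
      hECC fun y => ⟨f x, hk.2 _ _, (hf.isCrossing_iff x).2 hx⟩
    obtain ⟨M, hM, hMk, hMc⟩ := LinkDiagram.exists_circle
    obtain ⟨E, g, hE, hg, hg1, -, hgk, -⟩ := (M.toDiagram hM).exists_reduction
    have hEc (x : E.Dart) : ¬ E.IsCrossing x := fun hx => hMc _ ((hg.isCrossing_iff x).2 hx)
    have hiso := LinkDiagram.isomorphic_of_isKnot (hgk hMk) (hknot hk) hEc hnc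
      (fun x => hg1 x (hEc x)) fun x => hf1 x (hnc x)
    obtain ⟨n, hn, hnm⟩ := LinkDiagram.exists_isMosaicNumber hM
      (LinkDiagram.equivalent_trans (LinkDiagram.equivalent_trans hE
        (Relation.EqvGen.rel _ _ (LinkDiagram.Move.isomorphic hiso)))
        (LinkDiagram.equivalent_symm hDD'))
    exact ⟨n, hn, by omega⟩
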